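/- **Setting.** Let $d\ge 0$, $N\ge 1$, $v>0$, $\mathcal K(x,x')=\exp(-\|x-x'\|_2^2/(2v^2))$ on $\mathbb R^d$, $\lambda_0>0$, $\lambda=N\lambda_0$, $\kappa_{\min}>0$, $B_y\ge 0$, $c<1$, and $$0<\eta\le \frac{2}{1+\lambda_0+\lambda_0/\kappa_{\min}},\qquad 0<\epsilon_{\rm flip}\le c,\qquad \epsilon_{\rm sq},\widetilde\epsilon_{\rm sq},\widehat\epsilon_{\rm sq},\epsilon_{\rm inv}\in(0,1).$$ Put $B_\alpha=\frac1{N\kappa_{\min}}+\frac1N$, $$C_1=\frac{(\frac1{\sqrt{\lambda_0}}+1)B_y}{\lambda_0\sqrt{\kappa_{\min}}},\quad C_2=\frac{\frac{B_y}{\sqrt{\lambda_0}}+2(1+\lambda_0)}{\lambda_0(1-c)\sqrt{\kappa_{\min}}},\quad C_3=\frac{(\frac1{\sqrt{\lambda_0}}+1)B_y}{\lambda_0},\quad \widetilde B_w=C_1+C_2+C_3,$$ and let $B_w$ be any number with $B_w\ge \frac{C_1+C_2}{\sqrt N}+\frac{C_3}{N}$. **Approximants.** A ReLU network of width $n$ is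 $\phi(x)=\sum_{s=1}^n c_s\,\mathrm{ReLU}(a_sx+b_s)$. Call ReLU networks $\phi_{\rm flip},\phi_{\rm sq},\widetilde\phi_{\rm sq},\phi_{\rm inv},\widehat\phi_{\rm sq}$ *admissible* if $|\frac{x}{1-x}-\phi_{\rm flip}(x)|<\frac{\epsilon_{\rm flip}}N$ for $0\le x\le\frac1{1+N\kappa_{\min}}$; $|x^2-\phi_{\rm sq}(x)|<\frac{\epsilon_{\rm sq}}N$ for $|x|\le B_y+B_\alpha$; $|x^2-\widetilde\phi_{\rm sq}(x)|<\frac{\widetilde\epsilon_{\rm sq}}{N^2}$ for $|x|\le B_w+B_\alpha$; $|\frac1x-\phi_{\rm inv}(x)|<\epsilon_{\rm inv}$ for $\frac1{N+1}\le x\le1$; $|x^2-\widehat\phi_{\rm sq}(x)|<\frac{\widehat\epsilon_{\rm sq}}N$ for $|x|\le B_w+3$. **Transformer.** Tokens are $z=[x,y,w,\|x\|^2,k,\alpha,\beta,p,\widehat k,s,t,1]\in\mathbb R^{d+11}$. The prompt $Z$ has columns $z_0$ (dummy: $x=0$, $y=0$, $s=1$, $t=0$), $z_i$ for $1\le i\le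 N$ (with $x_i,y_i$, $s=t=0$) and $z_{N+1}$ (test: $x_{N+1}$, $y=0$, $s=0$, $t=1$); the slots $w,k,\alpha,\beta,p,\widehat k$ start at $0$. Every block consists of an optional single-head softmax attention layer and a two-layer ReLU MLP layer, both with residual connections; the transformer $\mathrm{TF}$ is the composition, in this order, of 1. *Read-in.* (a) Attention with scores $\langle W_Qz_i,W_Kz_j\rangle=\frac{1}{v^2}\big(x_i^\top x_j-\frac{\|x_i\|^2(1-s_j)+(1-s_i)\|x_j\|^2}{2}\big)$ and values $s_j$ written to slot $k$, token $N+1$ masked; MLP $\alpha\mathrel{+}=\phi_{\rm flip}(k)$. (b) MLP $\alpha\mathrel{+}=\mathrm{ReLU}(-\alpha-B_\alpha(1-t))-\mathrm{ReLU}(\alpha-B_\alpha(1-t))$. (c) MLP $\beta\mathrel{+}=\frac\eta4(\phi_{\rm sq}(y+\alpha)-\phi_{\rm sq}(y-\alpha))$. 2. *Iteration, repeated $\ell$ times.* (a) Attention with scores $-\|x_i-x_j\|^2/(2v^2)$ and values $-w_j$ written to slot $p$, tokens $0$ and $N+1$ masked; MLP $p\mathrel{+}=\mathrm{ReLU}(-p-B_w(1-t))-\mathrm{ReLU}(p-B_w(1-t))$.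 (b) MLP $w\mathrel{+}=-\frac{\eta\lambda}4(\widetilde\phi_{\rm sq}(w+\alpha)-\widetilde\phi_{\rm sq}(w-\alpha))+\beta+\eta p$ and $p\mathrel{+}=-p$. 3. *Read-out.* (a) Attention with scores $-\|x_i-x_j\|^2/(2v^2)$ and values $w_j$ written to slot $p$, token $0$ masked; MLP $\widehat k\mathrel{+}=\phi_{\rm inv}(k)$. (b) MLP $y\mathrel{+}=\frac N4(\widehat\phi_{\rm sq}(\widehat k/N+p)-\widehat\phi_{\rm sq}(\widehat k/N-p))$. (In the scores for iteration and read-out, the slot $\|x\|^2$ and the constant slot are used, so that they equal $\frac1{v^2}(x_i^\top x_j-\frac{\|x_i\|^2+\|x_j\|^2}2)$.) The readout is the $y$-slot of token $N+1$. **Proposition.** (i) Admissible networks exist, with widths $n_{\rm flip}\le \frac{2((1-\frac1{1+N\kappa_{\min}})^{-1/2}-1)}{\sqrt{\epsilon_{\rm flip}/N}}+1$, $n_{\rm sq}\le\frac{B_y+B_\alpha}{\sqrt{\epsilon_{\rm sq}/N}}+2$, $\widetilde n_{\rm sq}\le\frac{B_w+B_\alpha}{\sqrt{\widetilde\epsilon_{\rm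 sq}/N^2}}+2$, $n_{\rm inv}\le3\sqrt{(N+1)/\epsilon_{\rm inv}}$, $\widehat n_{\rm sq}\le\frac{B_w+3}{\sqrt{\widehat\epsilon_{\rm sq}/N}}+2$. (ii) For all admissible networks, every $\ell\ge0$, all $x_1,\dots,x_{N+1}\in\mathbb R^d$ and $y\in\mathbb R^N$ with $|y_i|\le B_y$, $\mathcal K(x_i,x_j)\ge\kappa_{\min}$ for $i\in\{1,\dots,N\}$, $j\in\{1,\dots,N+1\}$, and for the solution $w^*$ of $(K+\lambda I)w^*=y$, where $K=(\mathcal K(x_i,x_j))_{i,j=1}^N$, $$\Big|\mathrm{readout}(\mathrm{TF}(Z))-\sum_{i=1}^Nw_i^*\mathcal K(x_i,x_{N+1})\Big|\le(1-\eta\lambda_0(1-c))^\ell\,\frac{(\frac1{\sqrt{\lambda_0}}+1)B_y}{\lambda_0\sqrt{\kappa_{\min}}}+\frac{\frac{B_y}{\sqrt{\lambda_0}}\epsilon_{\rm flip}+(1+\lambda_0)(\epsilon_{\rm sq}+\widetilde\epsilon_{\rm sq})}{\lambda_0(1-c)\sqrt{\kappa_{\min}}}+\frac{\widehat\epsilon_{\rm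 sq}}2+\epsilon_{\rm inv}\widetilde B_w.$$ -/

import Mathlib

open scoped Matrix

namespace KernelTransformer

/-! Transformers: a prompt of `n` tokens with features indexed by `F` is the matrix whose columns
are the tokens. -/

/-- The ReLU activation. -/
def relu (x : ℝ) : ℝ := max x 0

/-- A single-head softmax attention layer with additive mask (entries `0` or `-∞`). -/
structure Attention (F : Type) (n : ℕ) where
  WQ : Matrix F F ℝ
  WK : Matrix F F ℝ
  WV : Matrix F F ℝ
  mask : Matrix (Fin n) (Fin n) EReal

/-- `exp(⟨W_Q z_i, W_K z_j⟩ + M_ij)`, with `exp(-∞) = 0`. -/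
noncomputable def Attention.score {F : Type} [Fintype F] {n : ℕ} (A : Attention F n)
    (Z : Matrix F (Fin n) ℝ) (i j : Fin n) : ℝ :=
  (EReal.exp ((((A.WQ *ᵥ Z.col i) ⬝ᵥ (A.WK *ᵥ Z.col j) : ℝ) : EReal) + A.mask i j)).toReal

/-- Softmax attention with residual connection. -/
noncomputable def Attention.apply {F : Type} [Fintype F] {n : ℕ} (A : Attention F n)
    (Z : Matrix F (Fin n) ℝ) : Matrix F (Fin n) ℝ :=
  Matrix.of fun r i =>
    Z r i + ∑ j, A.score Z i j / (∑ j', A.score Z i j') * (A.WV *ᵥ Z.col j) r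

/-- A two-layer ReLU perceptron acting on every token. -/
structure MLP (F : Type) where
  width : ℕ
  Win : Matrix (Fin width) F ℝ
  Wout : Matrix F (Fin width) ℝ

/-- `Z + W_out ReLU(W_in Z)`. -/
noncomputable def MLP.apply {F : Type} [Fintype F] {n : ℕ} (M : MLP F)
    (Z : Matrix F (Fin n) ℝ) : Matrix F (Fin n) ℝ :=
  Z + M.Wout * (M.Win * Z).map relu

/-- A transformer block: an attention layer followed by an MLP layer. In an MLP-only block the
attention layer is absent. -/
structure Block (F : Type) (n : ℕ) where
  attn : Option (Attention F n)
  mlp : MLP F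

noncomputable def Block.apply {F : Type} [Fintype F] {n : ℕ} (B : Block F n)
    (Z : Matrix F (Fin n) ℝ) : Matrix F (Fin n) ℝ :=
  B.mlp.apply (match B.attn with
    | none => Z
    | some A => A.apply Z)

/-- The network that applies the blocks of a list in order, the head of the list first. -/
noncomputable def runBlocks {F : Type} [Fintype F] {n : ℕ} (L : List (Block F n))
    (Z : Matrix F (Fin n) ℝ) : Matrix F (Fin n) ℝ :=
  L.foldl (fun Z' B => B.apply Z') Z

/-! Tokens `z = [x, y, w, ‖x‖², k, α, β, p, k̂, s, t, 1]` of dimension `d + 11`. -/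

/-- The eleven scalar coordinates of a token, in their order after the `d` coordinates of `x`. -/
inductive Slot : Type
  | y | w | sqNorm | k | alpha | beta | p | khat | s | t | one
deriving DecidableEq

instance : Fintype Slot where
  elems := {Slot.y, Slot.w, Slot.sqNorm, Slot.k, Slot.alpha, Slot.beta, Slot.p, Slot.khat, Slot.s,
    Slot.t, Slot.one}
  complete := by intro r; cases r <;> decide

abbrev Feature (d : ℕ) : Type := Fin d ⊕ Slot

/-- The coordinate functional reading a given slot, as a row vector. -/
def coord {d : ℕ} (r : Slot) : Feature d → ℝ := Pi.single (Sum.inr r) 1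

/-- The initial token with the given `x`, `y`, `s`, `t`; the other working slots are zero. -/
noncomputable def token {d : ℕ} (x : EuclideanSpace ℝ (Fin d)) (y s t : ℝ) : Feature d → ℝ
  | Sum.inl a => x a
  | Sum.inr Slot.y => y
  | Sum.inr Slot.sqNorm => ‖x‖ ^ 2
  | Sum.inr Slot.s => s
  | Sum.inr Slot.t => t
  | Sum.inr Slot.one => 1
  | Sum.inr _ => 0

/-- The prompt: column `0` is the dummy token (`x = 0`, `s = 1`), columns `1, …, N` are the
training tokens, column `N + 1` is the test token (`y = 0`, `t = 1`). -/
noncomputable def prompt {d N : ℕ} (x : Fin N → EuclideanSpace ℝ (Fin d)) (y : Fin N → ℝ)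
    (xtest : EuclideanSpace ℝ (Fin d)) : Matrix (Feature d) (Fin (N + 2)) ℝ :=
  Matrix.of fun r i =>
    (Fin.cons (token 0 0 1 0)
      (Fin.snoc (fun j : Fin N => token (x j) (y j) 0 0) (token xtest 0 0 1)) :
      Fin (N + 2) → Feature d → ℝ) i r

/-- The readout: the `y`-coordinate of the test token. -/
def readout {d N : ℕ} (Z : Matrix (Feature d) (Fin (N + 2)) ℝ) : ℝ :=
  Z (Sum.inr Slot.y) (Fin.last (N + 1))

/-! Univariate ReLU networks. -/

/-- The network `x ↦ ∑ s, c_s ReLU(a_s x + b_s)`. -/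
structure ReluNet where
  width : ℕ
  a : Fin width → ℝ
  b : Fin width → ℝ
  c : Fin width → ℝ

noncomputable def ReluNet.eval (φ : ReluNet) (x : ℝ) : ℝ :=
  ∑ s, φ.c s * relu (φ.a s * x + φ.b s)

/-- The five approximants in the construction: of `x / (1 - x)` (`flip`), of `1 / x` (`inv`), and
of `x²` (`sq` in the read-in phase, `sqIter` in the iteration phase, `sqOut` in the read-out). -/
structure Approximants where
  flip : ReluNet
  sq : ReluNet
  sqIter : ReluNet
  inv : ReluNet
  sqOut : ReluNet

/-! Building matrices. -/

/-- The output matrix whose only nonzero row is the one of slot `r`, equal to `c`. -/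
def outRow {d n : ℕ} (r : Slot) (c : Fin n → ℝ) : Matrix (Feature d) (Fin n) ℝ :=
  Matrix.of fun r' s => if r' = Sum.inr r then c s else 0

/-- A `D × D` matrix `W` with `W z = [x / v; u · z; u' · z; 0]`. -/
noncomputable def headMatrix {d : ℕ} (v : ℝ) (u u' : Feature d → ℝ) :
    Matrix (Feature d) (Feature d) ℝ :=
  Matrix.of fun r => match r with
    | Sum.inl a => (1 / v) • Pi.single (Sum.inl a) 1
    | Sum.inr Slot.y => u
    | Sum.inr Slot.w => u'
    | Sum.inr _ => 0

/-- The matrix `W` with `W z = (u · z) e_r`. -/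
def valueMatrix {d : ℕ} (r : Slot) (u : Feature d → ℝ) : Matrix (Feature d) (Feature d) ℝ :=
  Matrix.of fun r' => if r' = Sum.inr r then u else 0

/-- The mask that is `-∞` on the columns satisfying `P` and `0` elsewhere. -/
noncomputable def colMask {n : ℕ} (P : Fin n → Prop) [DecidablePred P] :
    Matrix (Fin n) (Fin n) EReal :=
  Matrix.of fun _ j => if P j then ⊥ else 0

/-- The MLP `z ↦ z + φ(u · z) e_r`. -/
noncomputable def evalMLP {d : ℕ} (φ : ReluNet) (u : Feature d → ℝ) (r : Slot) :
    MLP (Feature d) where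
  width := φ.width
  Win := Matrix.of fun s => φ.a s • u + φ.b s • coord Slot.one
  Wout := outRow r φ.c

/-- The MLP that clears the slot `r` of the test token and fixes it for the other tokens as long
as its absolute value there is at most `B`. -/
noncomputable def clearMLP (d : ℕ) (r : Slot) (B : ℝ) : MLP (Feature d) where
  width := 2
  Win := Matrix.of ![-coord r - B • (coord Slot.one - coord Slot.t),
    coord r - B • (coord Slot.one - coord Slot.t)]
  Wout := outRow r ![1, -1]

/-- The MLP `z ↦ z + m (φ(u · z + u' · z) - φ(u · z - u' · z)) e_r`. -/
noncomputable def productMLP {d : ℕ} (φ : ReluNet) (m : ℝ) (u u' : Feature d → ℝ) (r : Slot) :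
    MLP (Feature d) where
  width := φ.width + φ.width
  Win := Matrix.of (Fin.append
    (fun s => φ.a s • (u + u') + φ.b s • coord Slot.one)
    (fun s => φ.a s • (u - u') + φ.b s • coord Slot.one))
  Wout := outRow r (m • Fin.append φ.c (-φ.c))

/-! The blocks. -/

/-- Read-in attention: writes `k_i = 1 / (1 + ∑_j K(x_i, x_j))`; masks the test token. -/
noncomputable def readInAttention (d N : ℕ) (v : ℝ) : Attention (Feature d) (N + 2) where
  WQ := headMatrix v ((1 / v) • coord Slot.sqNorm)
    (-(1 / (2 * v)) • (coord Slot.one - coord Slot.s))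
  WK := headMatrix v (-(1 / (2 * v)) • (coord Slot.one - coord Slot.s))
    ((1 / v) • coord Slot.sqNorm)
  WV := valueMatrix Slot.k (coord Slot.s)
  mask := colMask fun j => j = Fin.last (N + 1)

/-- The three read-in blocks. -/
noncomputable def readInBlocks (d N : ℕ) (v η Bα : ℝ) (Φ : Approximants) :
    List (Block (Feature d) (N + 2)) :=
  [ { attn := some (readInAttention d N v)
      mlp := evalMLP Φ.flip (coord Slot.k) Slot.alpha },
    { attn := none
      mlp := clearMLP d Slot.alpha Bα },
    { attn := none
      mlp := productMLP Φ.sq (η / 4) (coord Slot.y) (coord Slot.alpha) Slot.beta } ]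

/-- Iteration attention: writes `p_i = -∑_j K(x_i, x_j) w_j / ∑_j K(x_i, x_j)`; masks the dummy
and the test token. -/
noncomputable def iterAttention (d N : ℕ) (v : ℝ) : Attention (Feature d) (N + 2) where
  WQ := headMatrix v ((1 / v) • coord Slot.sqNorm) (-(1 / (2 * v)) • coord Slot.one)
  WK := headMatrix v (-(1 / (2 * v)) • coord Slot.one) ((1 / v) • coord Slot.sqNorm)
  WV := valueMatrix Slot.p (-coord Slot.w)
  mask := colMask fun j => j = 0 ∨ j = Fin.last (N + 1)

/-- The MLP that performs one Richardson step on the slot `w` and resets the slot `p`. -/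
noncomputable def stepMLP (d : ℕ) (η lam : ℝ) (φ : ReluNet) : MLP (Feature d) where
  width := (φ.width + φ.width) + 4
  Win := Matrix.of (Fin.append
    (Fin.append
      (fun s => φ.a s • (coord Slot.w + coord Slot.alpha) + φ.b s • coord Slot.one)
      (fun s => φ.a s • (coord Slot.w - coord Slot.alpha) + φ.b s • coord Slot.one))
    ![coord Slot.beta, -coord Slot.beta, coord Slot.p, -coord Slot.p])
  Wout :=
    outRow Slot.w (Fin.append ((η * lam / 4) • Fin.append (-φ.c) φ.c) ![1, -1, η, -η]) +
    outRow Slot.p (Fin.append 0 ![0, 0, -1, 1])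

/-- The two blocks of one iteration. -/
noncomputable def iterBlocks (d N : ℕ) (v η lam Bw : ℝ) (Φ : Approximants) :
    List (Block (Feature d) (N + 2)) :=
  [ { attn := some (iterAttention d N v)
      mlp := clearMLP d Slot.p Bw },
    { attn := none
      mlp := stepMLP d η lam Φ.sqIter } ]

/-- Read-out attention: writes `p̂_i = ∑_j K(x_i, x_j) w_j / ∑_j K(x_i, x_j)` over all non-dummy
tokens `j`; masks the dummy token. -/
noncomputable def readOutAttention (d N : ℕ) (v : ℝ) : Attention (Feature d) (N + 2) where
  WQ := headMatrix v ((1 / v) • coord Slot.sqNorm) (-(1 / (2 * v)) • coord Slot.one)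
  WK := headMatrix v (-(1 / (2 * v)) • coord Slot.one) ((1 / v) • coord Slot.sqNorm)
  WV := valueMatrix Slot.p (coord Slot.w)
  mask := colMask fun j => j = 0

/-- The two read-out blocks. -/
noncomputable def readOutBlocks (d N : ℕ) (v : ℝ) (Φ : Approximants) :
    List (Block (Feature d) (N + 2)) :=
  [ { attn := some (readOutAttention d N v)
      mlp := evalMLP Φ.inv (coord Slot.k) Slot.khat },
    { attn := none
      mlp := productMLP Φ.sqOut ((N : ℝ) / 4) ((1 / (N : ℝ)) • coord Slot.khat) (coord Slot.p)
        Slot.y } ]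

/-- The complete network: read-in blocks, `ℓ` repetitions of the iteration blocks, read-out
blocks. Its weights do not depend on the prompt. -/
noncomputable def transformer (d N : ℕ) (v η lam Bα Bw : ℝ) (Φ : Approximants) (ℓ : ℕ) :
    List (Block (Feature d) (N + 2)) :=
  readInBlocks d N v η Bα Φ ++ (List.replicate ℓ (iterBlocks d N v η lam Bw Φ)).flatten ++
    readOutBlocks d N v Φ

/-! Kernel ridge regression and the constants. -/

/-- The Gaussian kernel `K(x, x') = exp(-‖x - x'‖² / (2 v²))`. -/
noncomputable def gaussKernel {d : ℕ} (v : ℝ) (x x' : EuclideanSpace ℝ (Fin d)) : ℝ :=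
  Real.exp (-(‖x - x'‖ ^ 2 / (2 * v ^ 2)))

noncomputable def kernelMatrix {d N : ℕ} (v : ℝ) (x : Fin N → EuclideanSpace ℝ (Fin d)) :
    Matrix (Fin N) (Fin N) ℝ :=
  Matrix.of fun i j => gaussKernel v (x i) (x j)

/-- The bound `B_α` on the entries of the approximate inverse degree matrix. -/
noncomputable def boundAlpha (N : ℕ) (κ : ℝ) : ℝ := 1 / (N * κ) + 1 / N

/-- The constant `(1/√λ₀ + 1) B_y / (λ₀ √κ)`. -/
noncomputable def initConst (lam0 κ By : ℝ) : ℝ :=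
  (1 / √lam0 + 1) * By / (lam0 * √κ)

/-- The constant `(B_y/√λ₀ + 2 (1 + λ₀)) / (λ₀ (1 - c) √κ)`. -/
noncomputable def errConst (lam0 κ By c : ℝ) : ℝ :=
  (By / √lam0 + 2 * (1 + lam0)) / (lam0 * (1 - c) * √κ)

/-- The entrywise bound on the iterates, of order `1/√N`. -/
noncomputable def boundW (N : ℕ) (lam0 κ By c : ℝ) : ℝ :=
  (initConst lam0 κ By + errConst lam0 κ By c) / √N + (1 / √lam0 + 1) * By / (lam0 * N)

/-- The `N`-independent relaxation of the bound on the iterates. -/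
noncomputable def boundWTilde (lam0 κ By c : ℝ) : ℝ :=
  initConst lam0 κ By + errConst lam0 κ By c + (1 / √lam0 + 1) * By / lam0

/-- The accuracies required of the five approximants. -/
structure Approximants.Accurate (Φ : Approximants) (N : ℕ) (κ By Bw : ℝ)
    (εflip εsq εsqIter εsqOut εinv : ℝ) : Prop where
  flip : ∀ x ∈ Set.Icc 0 (1 / (1 + N * κ)), |x / (1 - x) - Φ.flip.eval x| < εflip / N
  sq : ∀ x : ℝ, |x| ≤ By + boundAlpha N κ → |x ^ 2 - Φ.sq.eval x| < εsq / N
  sqIter : ∀ x : ℝ, |x| ≤ Bw + boundAlpha N κ → |x ^ 2 - Φ.sqIter.eval x| < εsqIter / N ^ 2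
  inv : ∀ x ∈ Set.Icc (1 / ((N : ℝ) + 1)) 1, |1 / x - Φ.inv.eval x| < εinv
  sqOut : ∀ x : ℝ, |x| ≤ Bw + 3 → |x ^ 2 - Φ.sqOut.eval x| < εsqOut / N

/-- The sizes of the five approximants, up to rounding. -/
structure Approximants.Small (Φ : Approximants) (N : ℕ) (κ By Bw : ℝ)
    (εflip εsq εsqIter εsqOut εinv : ℝ) : Prop where
  flip : (Φ.flip.width : ℝ) ≤ 2 * (1 / √(1 - 1 / (1 + N * κ)) - 1) / √(εflip / N) + 1
  sq : (Φ.sq.width : ℝ) ≤ (By + boundAlpha N κ) / √(εsq / N) + 2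
  sqIter : (Φ.sqIter.width : ℝ) ≤ (Bw + boundAlpha N κ) / √(εsqIter / N ^ 2) + 2
  inv : (Φ.inv.width : ℝ) ≤ 3 * √((N + 1) / εinv)
  sqOut : (Φ.sqOut.width : ℝ) ≤ (Bw + 3) / √(εsqOut / N) + 2

end KernelTransformer

namespace KernelTransformer

/-! Piecewise linear interpolation by ReLU networks. -/

/-! Let D be the diagonal matrix of the row sums of K. Softmax attention restricted to the training
tokens computes the averages D⁻¹Kw, so one pass through the iteration blocks is, up to small errors,
the Richardson step w ↦ w - η(D⁻¹Kw + λαw - αy) for ridge regression preconditioned by D⁻¹, with α ≈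
1/deg. The row sums are accessible because the dummy token has score exactly 1 in the read-in: it
yields k = 1/(1 + deg), and x/(1 - x) sends this to 1/deg. Products come from approximate squares by
polarization.

Errors are measured in the norm √(∑ deg_i u_i²). For its inner product D⁻¹K is self-adjoint with
spectrum in [0, 1] (`gaussKernel_quadratic_nonneg`, `IsKernel.quadratic_le`), and λα lies between
λ₀(1 - c) and λ₀/κ + λ₀c; the condition on η then makes each step a contraction with factor 1 -
ηλ₀(1 - c) (`IsKernel.contraction`). Replacing 1/deg by α disturbs the fixed point only through
(1/deg - α)Kw*, and Kw* is bounded independently of N (`IsKernel.abs_fit_le`). The remaining step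
errors sum to a geometric series.

The approximants are accurate only on bounded ranges, so each stage needs an entrywise bound on the
iterate, which follows from the norm bound of the same stage (`abs_iterate_le`, used in
`exists_iterState`). Clearing keeps α, β and w zero at the test token. The read-out average is an
average over 1 + ∑ K(x_test, x_j); multiplying by an approximation of this normalizer recovers the
prediction (`abs_transformer_sub_le`).

The widths follow from piecewise linear interpolation with knots that give every piece the same
error bound: equally spaced for x², equally spaced in u^(-1/2) for 1/u. -/

theorem relu_of_nonneg {x : ℝ} (hx : 0 ≤ x) : relu x = x := max_eq_left hx

theorem relu_of_nonpos {x : ℝ} (hx : x ≤ 0) : relu x = 0 := max_eq_right hx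

theorem relu_sub_relu_neg (x : ℝ) : relu x - relu (-x) = x := by
  rcases le_total 0 x with h | h
  · rw [relu_of_nonneg h, relu_of_nonpos (by linarith)]; ring
  · rw [relu_of_nonpos h, relu_of_nonneg (by linarith)]; ring

/-- The coefficient of the `k`-th unit of an interpolating network with slopes `m`. -/
def slopeJump (m : ℕ → ℝ) : ℕ → ℝ
  | 0 => m 0
  | k + 1 => m (k + 1) - m k

/-- Summation by parts: the jumps up to index k telescope to the slope `m k`, and continuity at the
knots fixes the constant. The sum is therefore the affine piece number k, shifted by `f 0`. -/
theorem sum_slopeJump (m t f : ℕ → ℝ) (hm : ∀ k, f (k + 1) = f k + m k * (t (k + 1) - t k))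
    (k : ℕ) (x : ℝ) :
    ∑ j ∈ Finset.range (k + 1), slopeJump m j * (x - t j) = f k - f 0 + m k * (x - t k) := by
  induction k with
  | zero => simp [slopeJump]
  | succ k ih =>
    rw [Finset.sum_range_succ, ih, slopeJump, hm k]
    ring

theorem exists_mem_knot_interval (t : ℕ → ℝ) (n : ℕ) (hn : 0 < n) {x : ℝ} (h0 : t 0 ≤ x)
    (h1 : x ≤ t n) : ∃ k < n, t k ≤ x ∧ x ≤ t (k + 1) := by
  induction n, hn using Nat.le_induction with
  | base => exact ⟨0, by norm_num, h0, h1⟩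
  | succ n hn ih =>
    rcases le_total x (t n) with h | h
    · obtain ⟨k, hk, h2⟩ := ih h
      exact ⟨k, by omega, h2⟩
    · exact ⟨n, by omega, h, h1⟩

/-- The network interpolating the values `f k` at the knots `t k`, up to the constant `f 0`. -/
noncomputable def interpolant (t f : ℕ → ℝ) (n : ℕ) : ReluNet where
  width := n
  a := fun _ => 1
  b := fun s => -t s
  c := fun s => slopeJump (fun k => (f (k + 1) - f k) / (t (k + 1) - t k)) s

/-- On piece k the units 0, …, k are active and all later ones vanish, so the network reduces to the
sum in `sum_slopeJump`. -/
theorem interpolant_eval {t f : ℕ → ℝ} {n : ℕ} (ht : StrictMono t) {k : ℕ} (hk : k < n) {x : ℝ}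
    (h0 : t k ≤ x) (h1 : x ≤ t (k + 1)) :
    (interpolant t f n).eval x =
      f k - f 0 + (f (k + 1) - f k) / (t (k + 1) - t k) * (x - t k) := by
  set m : ℕ → ℝ := fun k => (f (k + 1) - f k) / (t (k + 1) - t k) with hm
  have hstep : ∀ k, f (k + 1) = f k + m k * (t (k + 1) - t k) := by
    intro k
    have : t (k + 1) - t k ≠ 0 := (sub_pos.2 (ht (Nat.lt_succ_self k))).ne'
    simp only [hm]
    field_simp
    ring
  rw [← sum_slopeJump m t f hstep k x]
  have h2 : (interpolant t f n).eval x = ∑ j ∈ Finset.range n, slopeJump m j * relu (x - t j) := by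
    rw [Finset.sum_range]
    simp only [ReluNet.eval, interpolant, hm, one_mul, sub_eq_add_neg]
    rfl
  rw [h2, ← Finset.sum_subset (s₁ := Finset.range (k + 1))]
  · refine Finset.sum_congr rfl fun j hj => ?_
    have : t j ≤ t k := ht.monotone (by simpa [Nat.lt_succ_iff] using hj)
    rw [relu_of_nonneg (by linarith)]
  · intro j hj
    simp only [Finset.mem_range] at *
    omega
  · intro j _ hj
    have : t (k + 1) ≤ t j := ht.monotone (by simpa using hj)
    rw [relu_of_nonpos (by linarith), mul_zero]

/-- A network with a constant added, at the cost of one unit. -/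
def ReluNet.addConst (φ : ReluNet) (r : ℝ) : ReluNet where
  width := φ.width + 1
  a := Fin.cons 0 φ.a
  b := Fin.cons 1 φ.b
  c := Fin.cons r φ.c

theorem ReluNet.addConst_eval (φ : ReluNet) (r x : ℝ) :
    (φ.addConst r).eval x = r + φ.eval x := by
  have h : (φ.addConst r).eval x = ∑ s : Fin (φ.width + 1),
      (Fin.cons r φ.c : Fin (φ.width + 1) → ℝ) s *
        relu ((Fin.cons 0 φ.a : Fin (φ.width + 1) → ℝ) s * x +
          (Fin.cons 1 φ.b : Fin (φ.width + 1) → ℝ) s) := rfl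
  rw [h, Fin.sum_univ_succ]
  simp [ReluNet.eval, relu]

/-- The difference is -(x - a)(b - x), extremal at the midpoint. -/
theorem sq_sub_chord_le {a b x h : ℝ} (hab : b - a = h) (hh : h ≠ 0) (ha : a ≤ x) (hb : x ≤ b) :
    |x ^ 2 - (a ^ 2 + (b ^ 2 - a ^ 2) / (b - a) * (x - a))| ≤ (h / 2) ^ 2 := by
  have h1 : (b ^ 2 - a ^ 2) / (b - a) = a + b := by
    rw [hab, div_eq_iff hh, ← hab]; ring
  rw [h1, abs_le]
  subst hab
  constructor
  · nlinarith [sq_nonneg (x - (a + b) / 2)]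
  · nlinarith [mul_nonneg (sub_nonneg.2 ha) (sub_nonneg.2 hb), sq_nonneg ((b - a) / 2)]

/-- The chord of `1 / u` between `p⁻²` and `q⁻²` overestimates by at most `(p - q)²`. -/
theorem inv_sub_chord_le {p q u : ℝ} (hu : 0 < u)
    (h : (u * p ^ 2 - 1) * (u * q ^ 2 - 1) ≤ 0) :
    |1 / u - (p ^ 2 + q ^ 2 - u * (p ^ 2 * q ^ 2))| ≤ (p - q) ^ 2 := by
  have e1 : 1 / u - (p ^ 2 + q ^ 2 - u * (p ^ 2 * q ^ 2)) =
      (u * p ^ 2 - 1) * (u * q ^ 2 - 1) / u := by field_simp; ring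
  -- Completing the square: adding (p - q)² turns the error, which is nonpositive, into a square
  -- over u.
  have e2 : (u * p ^ 2 - 1) * (u * q ^ 2 - 1) / u + (p - q) ^ 2 = (u * (p * q) - 1) ^ 2 / u := by
    field_simp; ring
  rw [e1, abs_le]
  constructor
  · have : 0 ≤ (u * (p * q) - 1) ^ 2 / u := by positivity
    linarith
  · have : (u * p ^ 2 - 1) * (u * q ^ 2 - 1) / u ≤ 0 := div_nonpos_of_nonpos_of_nonneg h hu.le
    nlinarith [sq_nonneg (p - q)]

/-- A number of pieces for which the interpolation error `(L / n)²` is below `ε`. -/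
theorem exists_pieces {L ε : ℝ} (hL : 0 ≤ L) (hε : 0 < ε) :
    ∃ n : ℕ, 0 < n ∧ (n : ℝ) ≤ L / √ε + 1 ∧ (L / n) ^ 2 < ε := by
  have hs : 0 < √ε := Real.sqrt_pos.2 hε
  refine ⟨⌊L / √ε⌋₊ + 1, by omega, ?_, ?_⟩
  · push_cast
    linarith [Nat.floor_le (div_nonneg hL hs.le)]
  · have h1 := Nat.lt_floor_add_one (L / √ε)
    have h2 : (0 : ℝ) < (⌊L / √ε⌋₊ + 1 : ℕ) := by positivity
    have h3 : L / (⌊L / √ε⌋₊ + 1 : ℕ) < √ε := by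
      rw [div_lt_iff₀ h2]
      rw [div_lt_iff₀ hs] at h1
      push_cast
      linarith
    calc (L / (⌊L / √ε⌋₊ + 1 : ℕ)) ^ 2 < √ε ^ 2 := by gcongr
      _ = ε := Real.sq_sqrt hε.le

theorem exists_net_sq {R ε : ℝ} (hR : 0 < R) (hε : 0 < ε) :
    ∃ φ : ReluNet, (φ.width : ℝ) ≤ R / √ε + 2 ∧ ∀ x : ℝ, |x| ≤ R → |x ^ 2 - φ.eval x| < ε := by
  obtain ⟨n, hn, hw, he⟩ := exists_pieces hR.le hε
  have hn' : (0 : ℝ) < n := by exact_mod_cast hn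
  set h : ℝ := 2 * R / n with hh
  have hpos : 0 < h := by positivity
  set t : ℕ → ℝ := fun k => -R + k * h with ht
  have hmono : StrictMono t := by
    refine strictMono_nat_of_lt_succ fun k => ?_
    simp only [ht]; push_cast; linarith
  refine ⟨(interpolant t (fun k => t k ^ 2) n).addConst (t 0 ^ 2), ?_, fun x hx => ?_⟩
  · simp only [ReluNet.addConst, interpolant]; push_cast; linarith
  · rw [abs_le] at hx
    obtain ⟨k, hk, h0, h1⟩ := exists_mem_knot_interval t n hn (x := x) (by simp [ht]; linarith)
      (by simp only [ht, hh]; rw [mul_div_cancel₀ _ hn'.ne']; linarith)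
    rw [ReluNet.addConst_eval, interpolant_eval hmono hk h0 h1]
    have e := sq_sub_chord_le (h := h) (by simp only [ht]; push_cast; ring) hpos.ne' h0 h1
    have e2 : h / 2 = R / n := by rw [hh]; ring
    rw [e2] at e
    refine lt_of_le_of_lt (le_of_eq ?_) (lt_of_le_of_lt e he)
    congr 1
    ring

/-- The composition of a network with `x ↦ a x + b`. -/
def ReluNet.compAffine (φ : ReluNet) (a b : ℝ) : ReluNet where
  width := φ.width
  a := fun s => φ.a s * a
  b := fun s => φ.a s * b + φ.b s
  c := φ.c

theorem ReluNet.compAffine_eval (φ : ReluNet) (a b x : ℝ) :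
    (φ.compAffine a b).eval x = φ.eval (a * x + b) := by
  simp only [ReluNet.eval, ReluNet.compAffine]
  refine Finset.sum_congr rfl fun s _ => ?_
  congr 2
  ring

/-- With knots u = p⁻² and p running from 1 to 1/√lo in equal steps h, `inv_sub_chord_le` bounds the
error by h² on every piece, so the number of pieces depends on 1/√lo and not on 1/lo. The argument
is -u because increasing p makes -p⁻² increase; the subtracted 1 is the value at the first knot,
which the interpolant omits. -/
theorem exists_net_inv {lo ε : ℝ} (hlo : 0 < lo) (hlo1 : lo < 1) (hε : 0 < ε) :
    ∃ φ : ReluNet, (φ.width : ℝ) ≤ (1 / √lo - 1) / √ε + 1 ∧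
      ∀ u : ℝ, lo ≤ u → u ≤ 1 → |1 / u - 1 - φ.eval (-u)| < ε := by
  have hs : 0 < √lo := Real.sqrt_pos.2 hlo
  have hL : 0 < 1 / √lo - 1 := by
    rw [sub_pos, lt_div_iff₀ hs, one_mul]
    exact (Real.sqrt_lt' one_pos).2 (by simpa using hlo1)
  obtain ⟨n, hn, hw, he⟩ := exists_pieces hL.le hε
  have hn' : (0 : ℝ) < n := by exact_mod_cast hn
  set h : ℝ := (1 / √lo - 1) / n with hh
  have hpos : 0 < h := by positivity
  set p : ℕ → ℝ := fun k => 1 + k * h with hp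
  have hp0 : ∀ k, 0 < p k := fun k => by simp only [hp]; positivity
  have hpstep : ∀ k, p (k + 1) = p k + h := fun k => by simp only [hp]; push_cast; ring
  set t : ℕ → ℝ := fun k => -(1 / p k ^ 2) with ht
  have hmono : StrictMono t := by
    refine strictMono_nat_of_lt_succ fun k => ?_
    simp only [ht]
    have := hp0 k
    have := hpstep k
    rw [neg_lt_neg_iff]
    gcongr
    linarith
  have hpn : p n = 1 / √lo := by
    simp only [hp, hh]; rw [mul_div_cancel₀ _ hn'.ne']; ring
  refine ⟨interpolant t (fun k => p k ^ 2) n, hw, fun u h0 h1 => ?_⟩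
  have hu : 0 < u := hlo.trans_le h0
  obtain ⟨k, hk, k0, k1⟩ := exists_mem_knot_interval t n hn (x := -u)
    (by simp [ht, hp]; linarith)
    (by simp only [ht, hpn]; rw [div_pow, Real.sq_sqrt hlo.le]; simpa using h0)
  rw [interpolant_eval hmono hk k0 k1]
  have a0 := hp0 k
  have a1 := hp0 (k + 1)
  have a2 : p k < p (k + 1) := by linarith [hpstep k]
  simp only [ht, neg_le_neg_iff] at k0 k1
  rw [le_div_iff₀ (by positivity)] at k0
  rw [div_le_iff₀ (by positivity)] at k1
  have e := inv_sub_chord_le (p := p k) (q := p (k + 1)) hu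
    (mul_nonpos_of_nonpos_of_nonneg (by linarith) (by linarith))
  have e3 : (p k - p (k + 1)) ^ 2 = h ^ 2 := by rw [hpstep]; ring
  rw [e3] at e
  refine lt_of_le_of_lt (le_of_eq ?_) (lt_of_le_of_lt e he)
  congr 1
  have a3 : p (k + 1) ^ 2 - p k ^ 2 ≠ 0 := (by nlinarith : 0 < p (k + 1) ^ 2 - p k ^ 2).ne'
  have e4 : t (k + 1) - t k = (p (k + 1) ^ 2 - p k ^ 2) / (p k ^ 2 * p (k + 1) ^ 2) := by
    simp only [ht]
    field_simp
    ring
  have e5 : p 0 = 1 := by simp [hp]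
  rw [e4, div_div_eq_mul_div, mul_comm (p (k + 1) ^ 2 - p k ^ 2), mul_div_cancel_right₀ _ a3, e5]
  simp only [ht]
  field_simp
  ring

/-! ### Admissible approximants with the stated widths. -/

theorem boundAlpha_pos {N : ℕ} {κ : ℝ} (hN : 1 ≤ N) (hκ : 0 < κ) : 0 < boundAlpha N κ := by
  have : (0 : ℝ) < N := by exact_mod_cast hN
  unfold boundAlpha
  positivity

/-- Since x/(1 - x) = 1/u - 1 for u = 1 - x, the network for 1/u - 1 serves after a shift, with no
additional unit. -/
theorem exists_net_flip {N : ℕ} {κ ε : ℝ} (hN : 1 ≤ N) (hκ : 0 < κ) (hε : 0 < ε) :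
    ∃ φ : ReluNet, (φ.width : ℝ) ≤ 2 * (1 / √(1 - 1 / (1 + N * κ)) - 1) / √ε + 1 ∧
      ∀ x ∈ Set.Icc 0 (1 / (1 + N * κ)), |x / (1 - x) - φ.eval x| < ε := by
  have hN' : (0 : ℝ) < N := by exact_mod_cast hN
  have hNκ : 0 < N * κ := by positivity
  have hb : 0 < 1 / (1 + N * κ) := by positivity
  have hb1 : 1 / (1 + N * κ) < 1 := by rw [div_lt_one (by positivity)]; linarith
  obtain ⟨φ, hw, hφ⟩ := exists_net_inv (lo := 1 - 1 / (1 + N * κ)) (by linarith) (by linarith) hε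
  refine ⟨φ.compAffine 1 (-1), ?_, fun x hx => ?_⟩
  · refine (show ((φ.compAffine 1 (-1)).width : ℝ) = φ.width from rfl).le.trans (hw.trans ?_)
    have : 0 ≤ 1 / √(1 - 1 / (1 + N * κ)) - 1 := by
      rw [sub_nonneg, le_div_iff₀ (Real.sqrt_pos.2 (by linarith)), one_mul]
      exact Real.sqrt_le_one.2 (by linarith)
    gcongr
    linarith
  · have h := hφ (1 - x) (by linarith [hx.2]) (by linarith [hx.1])
    rw [ReluNet.compAffine_eval]
    have hx1 : 1 - x ≠ 0 := by linarith [hx.2]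
    have e : x / (1 - x) = 1 / (1 - x) - 1 := by field_simp; ring
    rw [e]
    convert h using 4
    ring

theorem exists_net_recip {N : ℕ} {ε : ℝ} (hN : 1 ≤ N) (hε : 0 < ε) (hε1 : ε < 1) :
    ∃ φ : ReluNet, (φ.width : ℝ) ≤ 3 * √((N + 1) / ε) ∧
      ∀ x ∈ Set.Icc (1 / ((N : ℝ) + 1)) 1, |1 / x - φ.eval x| < ε := by
  have hN' : (0 : ℝ) < N := by exact_mod_cast hN
  obtain ⟨φ, hw, hφ⟩ := exists_net_inv (lo := 1 / ((N : ℝ) + 1)) (by positivity)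
    (by rw [div_lt_one (by positivity)]; linarith) hε
  refine ⟨(φ.compAffine (-1) 0).addConst 1, ?_, fun x hx => ?_⟩
  · have e1 : (((φ.compAffine (-1) 0).addConst 1).width : ℝ) = φ.width + 1 := by
      simp [ReluNet.addConst, ReluNet.compAffine]
    have e2 : 1 / √(1 / ((N : ℝ) + 1)) = √((N : ℝ) + 1) := by
      rw [Real.sqrt_div zero_le_one, Real.sqrt_one, one_div_one_div]
    rw [e2, sub_div, ← Real.sqrt_div (by positivity)] at hw
    rw [e1]
    -- The rounding unit and the unit for the constant 1 are each absorbed by one copy of this root;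
    -- hence the factor 3.
    have e3 : 1 ≤ √((N + 1) / ε) := by
      rw [Real.one_le_sqrt, le_div_iff₀ hε]
      linarith
    have e4 : 0 ≤ 1 / √ε := by positivity
    linarith
  · have h := hφ x hx.1 hx.2
    rw [ReluNet.addConst_eval, ReluNet.compAffine_eval]
    convert h using 2
    ring_nf

theorem boundW_nonneg {N : ℕ} {lam0 κ By c : ℝ} (hlam0 : 0 < lam0) (hκ : 0 < κ) (hBy : 0 ≤ By)
    (hc : c < 1) : 0 ≤ boundW N lam0 κ By c := by
  have : 0 < 1 - c := by linarith
  unfold boundW initConst errConst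
  positivity

theorem exists_approximants {N : ℕ} {lam0 κ By c Bw εflip εsq εsqIter εsqOut εinv : ℝ}
    (hN : 1 ≤ N) (hlam0 : 0 < lam0) (hκ : 0 < κ) (hBy : 0 ≤ By) (hc : c < 1)
    (hBw : boundW N lam0 κ By c ≤ Bw) (hflip : 0 < εflip) (hsq : 0 < εsq)
    (hsqIter : 0 < εsqIter) (hsqOut : 0 < εsqOut) (hinv : 0 < εinv) (hinv' : εinv < 1) :
    ∃ Φ : Approximants, Φ.Accurate N κ By Bw εflip εsq εsqIter εsqOut εinv ∧
      Φ.Small N κ By Bw εflip εsq εsqIter εsqOut εinv := by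
  have hN' : (0 : ℝ) < N := by exact_mod_cast hN
  have hα := boundAlpha_pos hN hκ
  have hBw0 : 0 ≤ Bw := (boundW_nonneg hlam0 hκ hBy hc).trans hBw
  obtain ⟨φ₁, w₁, h₁⟩ := exists_net_flip hN hκ (ε := εflip / N) (by positivity)
  obtain ⟨φ₂, w₂, h₂⟩ := exists_net_sq (R := By + boundAlpha N κ) (ε := εsq / N)
    (by positivity) (by positivity)
  obtain ⟨φ₃, w₃, h₃⟩ := exists_net_sq (R := Bw + boundAlpha N κ) (ε := εsqIter / N ^ 2)
    (by positivity) (by positivity)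
  obtain ⟨φ₄, w₄, h₄⟩ := exists_net_recip hN hinv hinv'
  obtain ⟨φ₅, w₅, h₅⟩ := exists_net_sq (R := Bw + 3) (ε := εsqOut / N)
    (by positivity) (by positivity)
  exact ⟨⟨φ₁, φ₂, φ₃, φ₄, φ₅⟩, ⟨h₁, h₂, h₃, h₄, h₅⟩, ⟨w₁, w₂, w₃, w₄, w₅⟩⟩

/-! The Gaussian kernel. -/

theorem gaussKernel_self {d : ℕ} (v : ℝ) (x : EuclideanSpace ℝ (Fin d)) :
    gaussKernel v x x = 1 := by simp [gaussKernel]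

theorem gaussKernel_comm {d : ℕ} (v : ℝ) (x x' : EuclideanSpace ℝ (Fin d)) :
    gaussKernel v x x' = gaussKernel v x' x := by simp only [gaussKernel, norm_sub_rev]

theorem gaussKernel_pos {d : ℕ} (v : ℝ) (x x' : EuclideanSpace ℝ (Fin d)) :
    0 < gaussKernel v x x' := Real.exp_pos _

theorem gaussKernel_le_one {d : ℕ} (v : ℝ) (x x' : EuclideanSpace ℝ (Fin d)) :
    gaussKernel v x x' ≤ 1 := by
  rw [gaussKernel, Real.exp_le_one_iff, neg_nonpos]
  positivity

/-- Schur product argument: expanding one factor of the Gram entry and absorbing `x i a` into the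
coefficient `u i` writes the form for k + 1 as a sum over a of forms for k. -/
theorem sum_mul_gram_pow_nonneg {ι α : Type*} [Fintype ι] [Fintype α] (x : ι → α → ℝ) (k : ℕ) :
    ∀ u : ι → ℝ, 0 ≤ ∑ i, ∑ j, u i * u j * (∑ a, x i a * x j a) ^ k := by
  induction k with
  | zero =>
    intro u
    simp only [pow_zero, mul_one]
    rw [← Finset.sum_mul_sum]
    exact mul_self_nonneg _
  | succ k ih =>
    intro u
    have h : ∑ i, ∑ j, u i * u j * (∑ a, x i a * x j a) ^ (k + 1) =
        ∑ a, ∑ i, ∑ j, (u i * x i a) * (u j * x j a) * (∑ a, x i a * x j a) ^ k := by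
      symm
      rw [Finset.sum_comm]
      refine Finset.sum_congr rfl fun i _ => ?_
      rw [Finset.sum_comm]
      refine Finset.sum_congr rfl fun j _ => ?_
      symm
      rw [pow_succ, mul_comm (_ ^ k), ← mul_assoc, Finset.mul_sum, Finset.sum_mul]
      refine Finset.sum_congr rfl fun a _ => ?_
      ring
    rw [h]
    exact Finset.sum_nonneg fun a _ => ih _

theorem sum_mul_exp_gram_nonneg {ι α : Type*} [Fintype ι] [Fintype α] (x : ι → α → ℝ)
    (u : ι → ℝ) : 0 ≤ ∑ i, ∑ j, u i * u j * Real.exp (∑ a, x i a * x j a) := by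
  have h : HasSum (fun k : ℕ => ∑ i, ∑ j, u i * u j * ((∑ a, x i a * x j a) ^ k / k.factorial))
      (∑ i, ∑ j, u i * u j * Real.exp (∑ a, x i a * x j a)) := by
    refine hasSum_sum fun i _ => hasSum_sum fun j _ => HasSum.mul_left _ ?_
    rw [Real.exp_eq_exp_ℝ]
    exact NormedSpace.expSeries_div_hasSum_exp _
  refine h.nonneg fun k => ?_
  have e : ∑ i, ∑ j, u i * u j * ((∑ a, x i a * x j a) ^ k / k.factorial) =
      (∑ i, ∑ j, u i * u j * (∑ a, x i a * x j a) ^ k) / k.factorial := by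
    simp only [Finset.sum_div, mul_div_assoc]
  rw [e]
  exact div_nonneg (sum_mul_gram_pow_nonneg x k u) (by positivity)

theorem norm_sub_sq_coord {d : ℕ} (x x' : EuclideanSpace ℝ (Fin d)) :
    ‖x - x'‖ ^ 2 = ‖x‖ ^ 2 + ‖x'‖ ^ 2 - 2 * ∑ a, x a * x' a := by
  simp only [EuclideanSpace.real_norm_sq_eq, Finset.mul_sum, ← Finset.sum_add_distrib,
    ← Finset.sum_sub_distrib, PiLp.sub_apply]
  exact Finset.sum_congr rfl fun a _ => by ring

/-- The kernel is exp of the Gram matrix of x/v, conjugated by the positive diagonal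
exp(-‖x‖²/(2v²)); the diagonal is absorbed into the coefficients. -/
theorem gaussKernel_quadratic_nonneg {d : ℕ} {ι : Type*} [Fintype ι] {v : ℝ} (hv : 0 < v)
    (x : ι → EuclideanSpace ℝ (Fin d)) (u : ι → ℝ) :
    0 ≤ ∑ i, ∑ j, u i * u j * gaussKernel v (x i) (x j) := by
  have h := sum_mul_exp_gram_nonneg (fun i a => x i a / v)
    (fun i => u i * Real.exp (-(‖x i‖ ^ 2 / (2 * v ^ 2))))
  refine h.trans_eq (Finset.sum_congr rfl fun i _ => Finset.sum_congr rfl fun j _ => ?_)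
  have e : gaussKernel v (x i) (x j) = Real.exp (-(‖x i‖ ^ 2 / (2 * v ^ 2))) *
      Real.exp (-(‖x j‖ ^ 2 / (2 * v ^ 2))) * Real.exp (∑ a, x i a / v * (x j a / v)) := by
    rw [gaussKernel, ← Real.exp_add, ← Real.exp_add, norm_sub_sq_coord]
    congr 1
    have : ∑ a, x i a / v * (x j a / v) = (∑ a, x i a * x j a) / v ^ 2 := by
      rw [Finset.sum_div]
      exact Finset.sum_congr rfl fun a _ => by ring
    rw [this]
    field_simp
    ring
  rw [e]
  ring

/-! Perturbed Richardson iteration for `(K + λ) w = y`, preconditioned by the degrees. -/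

/-- The properties of a Gaussian kernel matrix with entries at least `κ` that the analysis uses. -/
structure IsKernel {ι : Type*} [Fintype ι] (K : ι → ι → ℝ) (κ : ℝ) : Prop where
  symm : ∀ i j, K i j = K j i
  diag : ∀ i, K i i = 1
  lower : ∀ i j, κ ≤ K i j
  upper : ∀ i j, K i j ≤ 1
  quadratic_nonneg : ∀ u : ι → ℝ, 0 ≤ ∑ i, ∑ j, u i * u j * K i j

section Richardson

variable {ι : Type*} [Fintype ι]

/-- The row sums of `K`. -/
def deg (K : ι → ι → ℝ) (i : ι) : ℝ := ∑ j, K i j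

theorem IsKernel.deg_le {K : ι → ι → ℝ} {κ : ℝ} (hK : IsKernel K κ) (i : ι) :
    deg K i ≤ Fintype.card ι := by
  unfold deg
  exact (Finset.sum_le_sum fun j _ => hK.upper i j).trans_eq (by simp)

theorem IsKernel.le_deg {K : ι → ι → ℝ} {κ : ℝ} (hK : IsKernel K κ) (i : ι) :
    Fintype.card ι * κ ≤ deg K i := by
  unfold deg
  exact (Finset.sum_le_sum fun j _ => hK.lower i j).trans_eq' (by simp)

/-- Cauchy–Schwarz for the semi-inner product K between w and the basis vector e_i, which has length
1 because the diagonal of K is 1. It is obtained by testing positivity on w - (Kw)_i e_i. -/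
theorem IsKernel.sq_apply_le {K : ι → ι → ℝ} {κ : ℝ} (hK : IsKernel K κ) (w : ι → ℝ) (i : ι) :
    (∑ j, K i j * w j) ^ 2 ≤ ∑ i, ∑ j, w i * w j * K i j := by
  classical
  set b := ∑ j, K i j * w j with hb
  have h := hK.quadratic_nonneg (fun j => w j - b * (if j = i then 1 else 0))
  have e : ∑ k, ∑ j, (w k - b * (if k = i then 1 else 0)) * (w j - b * (if j = i then 1 else 0)) *
      K k j = ∑ k, ∑ j, w k * w j * K k j - b * ∑ j, w j * K i j - b * ∑ k, w k * K k i +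
        b ^ 2 * K i i := by
    have e1 : ∀ k j, (w k - b * (if k = i then 1 else 0)) *
        (w j - b * (if j = i then 1 else 0)) * K k j = w k * w j * K k j -
        (if k = i then b * (w j * K k j) else 0) - (if j = i then b * (w k * K k j) else 0) +
        (if k = i then (if j = i then b ^ 2 * K k j else 0) else 0) := by
      intro k j
      by_cases h1 : k = i <;> by_cases h2 : j = i <;> simp [h1, h2] <;> ring
    simp only [e1, Finset.sum_add_distrib, Finset.sum_sub_distrib, Finset.mul_sum]
    simp
  have e2 : ∑ j, w j * K i j = b := by simp only [hb, mul_comm]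
  have e3 : ∑ k, w k * K k i = b := by
    simp only [hb]
    exact Finset.sum_congr rfl fun k _ => by rw [hK.symm k i, mul_comm]
  rw [e, e2, e3, hK.diag] at h
  nlinarith

/-- The fitted values of kernel ridge regression are entrywise bounded. -/
theorem IsKernel.abs_fit_le {K : ι → ι → ℝ} {κ : ℝ} (hK : IsKernel K κ) {lam0 By : ℝ}
    (hlam0 : 0 < lam0) (hBy : 0 ≤ By) {w y : ι → ℝ} (hy : ∀ i, |y i| ≤ By)
    (hw : ∀ i, ∑ j, K i j * w j + Fintype.card ι * lam0 * w i = y i) (i : ι) :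
    |∑ j, K i j * w j| ≤ By / √lam0 := by
  have : Nonempty ι := ⟨i⟩
  have hN : (0 : ℝ) < Fintype.card ι := by exact_mod_cast Fintype.card_pos
  set N : ℝ := (Fintype.card ι : ℝ) with hN_def
  have h1 : ∑ i, ∑ j, w i * w j * K i j = ∑ i, w i * (y i - N * lam0 * w i) := by
    refine Finset.sum_congr rfl fun i _ => ?_
    rw [← hw i, add_sub_cancel_right, Finset.mul_sum]
    exact Finset.sum_congr rfl fun j _ => by ring
  -- Each summand is a concave quadratic in `w i` with maximum y_i²/(4 N λ₀); the factor 1/4 is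
  -- given away.
  have h2 : ∑ i, w i * (y i - N * lam0 * w i) ≤ ∑ i : ι, By ^ 2 / (N * lam0) := by
    refine Finset.sum_le_sum fun i _ => ?_
    have h3 : y i ^ 2 ≤ By ^ 2 := sq_le_sq' (by linarith [abs_le.1 (hy i)])
      (abs_le.1 (hy i)).2
    rw [le_div_iff₀ (by positivity)]
    nlinarith [sq_nonneg (y i - 2 * (N * lam0) * w i), sq_nonneg (y i)]
  have h4 : ∑ i : ι, By ^ 2 / (N * lam0) = By ^ 2 / lam0 := by
    simp only [Finset.sum_const, Finset.card_univ, nsmul_eq_mul, ← hN_def]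
    field_simp
  have h5 : (∑ j, K i j * w j) ^ 2 ≤ (By / √lam0) ^ 2 := by
    rw [div_pow, Real.sq_sqrt hlam0.le, ← h4]
    exact (hK.sq_apply_le w i).trans (h1.le.trans h2)
  exact abs_le_of_sq_le_sq h5 (by positivity)

/-- Solve the i-th equation for N λ₀ w_i = y_i - (Kw)_i and bound both terms by `hy` and
`IsKernel.abs_fit_le`. -/
theorem IsKernel.abs_solution_le {K : ι → ι → ℝ} {κ : ℝ} (hK : IsKernel K κ) {lam0 By : ℝ}
    (hlam0 : 0 < lam0) (hBy : 0 ≤ By) {w y : ι → ℝ} (hy : ∀ i, |y i| ≤ By)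
    (hw : ∀ i, ∑ j, K i j * w j + Fintype.card ι * lam0 * w i = y i) (i : ι) :
    |w i| ≤ (1 / √lam0 + 1) * By / (lam0 * Fintype.card ι) := by
  have : Nonempty ι := ⟨i⟩
  have hN : (0 : ℝ) < Fintype.card ι := by exact_mod_cast Fintype.card_pos
  have h1 := abs_le.1 (hK.abs_fit_le hlam0 hBy hy hw i)
  have h2 := abs_le.1 (hy i)
  have h3 := hw i
  have e : (1 / √lam0 + 1) * By = By / √lam0 + By := by ring
  rw [e, abs_le, ← neg_div, div_le_iff₀ (by positivity), le_div_iff₀ (by positivity)]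
  constructor <;> nlinarith

/-- The norm `√(∑ i, δ i * u i ^ 2)`. -/
noncomputable def wnorm (δ u : ι → ℝ) : ℝ := √(∑ i, δ i * u i ^ 2)

theorem wnorm_nonneg (δ u : ι → ℝ) : 0 ≤ wnorm δ u := Real.sqrt_nonneg _

theorem wnorm_sq {δ : ι → ℝ} (hδ : ∀ i, 0 ≤ δ i) (u : ι → ℝ) :
    wnorm δ u ^ 2 = ∑ i, δ i * u i ^ 2 :=
  Real.sq_sqrt (Finset.sum_nonneg fun i _ => mul_nonneg (hδ i) (sq_nonneg _))

theorem wnorm_add_le {δ : ι → ℝ} (hδ : ∀ i, 0 ≤ δ i) (u u' : ι → ℝ) :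
    wnorm δ (fun i => u i + u' i) ≤ wnorm δ u + wnorm δ u' := by
  have h : ∀ u : ι → ℝ, wnorm δ u = ‖WithLp.toLp 2 (fun i => √(δ i) * u i)‖ := by
    intro u
    simp [wnorm, EuclideanSpace.norm_eq, mul_pow, Real.sq_sqrt (hδ _)]
  rw [h, h, h]
  refine (norm_add_le _ _).trans_eq' ?_
  congr 1
  ext i
  simp [mul_add]

/-- There are N entries with weights at most N, so the norm costs a factor N: entrywise errors of
order 1/N have norm of order 1. This is why accuracies are divided by N. -/
theorem wnorm_le_of_abs_le {δ : ι → ℝ} {b : ℝ} (hδ : ∀ i, δ i ≤ Fintype.card ι) {u : ι → ℝ} (hu : ∀ i, |u i| ≤ b) (hb : 0 ≤ b) :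
    wnorm δ u ≤ Fintype.card ι * b := by
  refine Real.sqrt_le_iff.2 ⟨by positivity, ?_⟩
  have : ∑ i, δ i * u i ^ 2 ≤ ∑ _i : ι, (Fintype.card ι : ℝ) * b ^ 2 := by
    refine Finset.sum_le_sum fun i _ => ?_
    have : u i ^ 2 ≤ b ^ 2 := by rw [← sq_abs]; gcongr; exact hu i
    exact mul_le_mul (hδ i) this (sq_nonneg _) (by positivity)
  refine this.trans_eq ?_
  simp
  ring

/-- If a symmetric form is bounded by `ρ` times the weighted norm, then so is the operator that
represents it. -/
theorem wnorm_apply_le {δ : ι → ℝ} (hδ : ∀ i, 0 ≤ δ i) {ρ : ℝ} (hρ : 0 < ρ)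
    (T : (ι → ℝ) →ₗ[ℝ] ι → ℝ)
    (hsymm : ∀ u u', ∑ i, δ i * T u i * u' i = ∑ i, δ i * T u' i * u i)
    (hupper : ∀ u, ∑ i, δ i * T u i * u i ≤ ρ * ∑ i, δ i * u i ^ 2)
    (hlower : ∀ u, -(ρ * ∑ i, δ i * u i ^ 2) ≤ ∑ i, δ i * T u i * u i) (u : ι → ℝ) :
    wnorm δ (T u) ≤ ρ * wnorm δ u := by
  refine abs_le_of_sq_le_sq' ?_ (mul_nonneg hρ.le (wnorm_nonneg _ _)) |>.2
  rw [mul_pow, wnorm_sq hδ, wnorm_sq hδ]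
  set P : (ι → ℝ) → (ι → ℝ) → ℝ := fun u u' => ∑ i, δ i * T u i * u' i with hP
  -- Polarization at u ± s T u: the two form values differ by 4s‖T u‖², and the parallelogram law
  -- bounds this by 2ρ‖u‖² + 2ρs²‖T u‖². With s = 1/ρ the last term is half of the left side.
  set s : ℝ := 1 / ρ
  set x := T u with hx
  have h1 := hupper (u + s • x)
  have h2 := hlower (u - s • x)
  have e0 : ∑ i, δ i * T x i * u i = ∑ i, δ i * x i ^ 2 := by
    rw [hsymm x u, ← hx]
    exact Finset.sum_congr rfl fun i _ => by ring
  have e0' : ∑ i, δ i * T u i * x i = ∑ i, δ i * x i ^ 2 := by rw [← e0, hsymm x u]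
  have e1 : ∑ i, δ i * T (u + s • x) i * (u + s • x) i =
      ∑ i, δ i * T u i * u i + s * ∑ i, δ i * T x i * u i + s * ∑ i, δ i * T u i * x i +
        s ^ 2 * ∑ i, δ i * T x i * x i := by
    simp only [map_add, map_smul, Pi.add_apply, Pi.smul_apply, smul_eq_mul, Finset.mul_sum,
      ← Finset.sum_add_distrib]
    exact Finset.sum_congr rfl fun i _ => by ring
  have e2 : ∑ i, δ i * T (u - s • x) i * (u - s • x) i =
      ∑ i, δ i * T u i * u i - s * ∑ i, δ i * T x i * u i - s * ∑ i, δ i * T u i * x i +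
        s ^ 2 * ∑ i, δ i * T x i * x i := by
    simp only [map_sub, map_smul, Pi.sub_apply, Pi.smul_apply, smul_eq_mul, Finset.mul_sum,
      ← Finset.sum_add_distrib, ← Finset.sum_sub_distrib]
    exact Finset.sum_congr rfl fun i _ => by ring
  have e3 : ∑ i, δ i * (u + s • x) i ^ 2 = ∑ i, δ i * u i ^ 2 +
      2 * s * ∑ i, δ i * u i * x i + s ^ 2 * ∑ i, δ i * x i ^ 2 := by
    simp only [Pi.add_apply, Pi.smul_apply, smul_eq_mul, Finset.mul_sum, ← Finset.sum_add_distrib]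
    exact Finset.sum_congr rfl fun i _ => by ring
  have e4 : ∑ i, δ i * (u - s • x) i ^ 2 = ∑ i, δ i * u i ^ 2 -
      2 * s * ∑ i, δ i * u i * x i + s ^ 2 * ∑ i, δ i * x i ^ 2 := by
    simp only [Pi.sub_apply, Pi.smul_apply, smul_eq_mul, Finset.mul_sum, ← Finset.sum_add_distrib,
      ← Finset.sum_sub_distrib]
    exact Finset.sum_congr rfl fun i _ => by ring
  rw [e1, e0, e0', e3] at h1
  rw [e2, e0, e0', e4] at h2
  set X := ∑ i, δ i * x i ^ 2
  set U := ∑ i, δ i * u i ^ 2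
  have hs : ρ * s = 1 := mul_one_div_cancel hρ.ne'
  have h3 : 4 * s * X ≤ ρ * (2 * U + 2 * s ^ 2 * X) := by linarith
  have h4 : ρ * s ^ 2 * X = s * X := by rw [pow_two, ← mul_assoc, hs, one_mul]
  have h5 : s * X ≤ ρ * U := by linarith
  calc X = ρ * (s * X) := by rw [← mul_assoc, hs, one_mul]
    _ ≤ ρ * (ρ * U) := by gcongr
    _ = ρ ^ 2 * U := by ring

/-- Use 2 u_i u_j ≤ u_i² + u_j² with the nonnegative weights K_ij and symmetry. In the
degree-weighted inner product this says that D⁻¹K is at most the identity. -/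
theorem IsKernel.quadratic_le {K : ι → ι → ℝ} {κ : ℝ} (hK : IsKernel K κ) (hκ : 0 ≤ κ)
    (u : ι → ℝ) : ∑ i, ∑ j, u i * u j * K i j ≤ ∑ i, deg K i * u i ^ 2 := by
  have h1 : ∑ i, ∑ j, u i * u j * K i j ≤
      ∑ i, ∑ j, (K i j * u i ^ 2 / 2 + K i j * u j ^ 2 / 2) := by
    refine Finset.sum_le_sum fun i _ => Finset.sum_le_sum fun j _ => ?_
    nlinarith [mul_nonneg (hκ.trans (hK.lower i j)) (sq_nonneg (u i - u j))]
  have h2 : ∑ i, ∑ j, K i j * u i ^ 2 / 2 = ∑ i, deg K i * u i ^ 2 / 2 := by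
    refine Finset.sum_congr rfl fun i _ => ?_
    rw [deg, ← Finset.sum_div, ← Finset.sum_mul]
  have h3 : ∑ i, ∑ j, K i j * u j ^ 2 / 2 = ∑ i, deg K i * u i ^ 2 / 2 := by
    rw [← h2, Finset.sum_comm]
    exact Finset.sum_congr rfl fun i _ => Finset.sum_congr rfl fun j _ => by rw [hK.symm]
  refine h1.trans_eq ?_
  simp only [Finset.sum_add_distrib]
  rw [h2, h3, ← Finset.sum_add_distrib]
  exact Finset.sum_congr rfl fun i _ => by ring

theorem IsKernel.deg_pos [Nonempty ι] {K : ι → ι → ℝ} {κ : ℝ} (hK : IsKernel K κ) (hκ : 0 < κ)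
    (i : ι) : 0 < deg K i := by
  have hN : (0 : ℝ) < Fintype.card ι := by exact_mod_cast Fintype.card_pos
  exact (mul_pos hN hκ).trans_le (hK.le_deg i)

theorem IsKernel.le_one [Nonempty ι] {K : ι → ι → ℝ} {κ : ℝ} (hK : IsKernel K κ) : κ ≤ 1 := by
  obtain ⟨i⟩ := ‹Nonempty ι›
  exact (hK.lower i i).trans_eq (hK.diag i)

/-- Because κ ≤ 1, the condition on η gives η + 2ηλ₀ ≤ 2, hence ηλ₀ < 1. -/
theorem rate_pos {lam0 κ c η : ℝ} (hκ : 0 < κ) (hκ1 : κ ≤ 1) (hlam0 : 0 < lam0) (hc0 : 0 < c)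
    (hη : 0 < η) (hη' : η ≤ 2 / (1 + lam0 + lam0 / κ)) : 0 < 1 - η * lam0 * (1 - c) := by
  rw [le_div_iff₀ (by positivity)] at hη'
  have h1 : lam0 ≤ lam0 / κ := by
    rw [le_div_iff₀ hκ]
    nlinarith
  have h2 : η * lam0 ≤ η * (lam0 / κ) := by gcongr
  have h3 : 0 < η * lam0 * c := by positivity
  nlinarith

/-- The error of the preconditioned Richardson iteration is contracted. -/
theorem IsKernel.contraction [Nonempty ι] {K : ι → ι → ℝ} {κ : ℝ} (hK : IsKernel K κ)
    {lam0 c η : ℝ} (hκ : 0 < κ) (hlam0 : 0 < lam0) (hc0 : 0 < c) (hη : 0 < η)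
    (hη' : η ≤ 2 / (1 + lam0 + lam0 / κ)) {γ : ι → ℝ} (hγ : ∀ i, lam0 * (1 - c) ≤ γ i)
    (hγ' : ∀ i, γ i ≤ lam0 / κ + lam0 * c) (u : ι → ℝ) :
    wnorm (deg K) (fun i => u i - η * ((∑ j, K i j * u j) / deg K i + γ i * u i)) ≤
      (1 - η * lam0 * (1 - c)) * wnorm (deg K) u := by
  have hd := hK.deg_pos hκ
  let T : (ι → ℝ) →ₗ[ℝ] ι → ℝ :=
    { toFun := fun u i => u i - η * ((∑ j, K i j * u j) / deg K i + γ i * u i)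
      map_add' := by
        intro u u'
        ext i
        simp only [Pi.add_apply, mul_add, Finset.sum_add_distrib]
        ring
      map_smul' := by
        intro r u
        ext i
        have : ∑ j, K i j * (r * u j) = r * ∑ j, K i j * u j := by
          rw [Finset.mul_sum]
          exact Finset.sum_congr rfl fun j _ => by ring
        simp only [Pi.smul_apply, smul_eq_mul, RingHom.id_apply, this]
        ring }
  have hT : ∀ u u' : ι → ℝ, ∑ i, deg K i * T u i * u' i = ∑ i, deg K i * (u i * u' i) -
      η * ∑ i, ∑ j, u' i * u j * K i j - η * ∑ i, γ i * (deg K i * (u i * u' i)) := by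
    intro u u'
    simp only [Finset.mul_sum, ← Finset.sum_sub_distrib]
    refine Finset.sum_congr rfl fun i _ => ?_
    have h1 : ∑ j, η * (u' i * u j * K i j) = η * u' i * ∑ j, K i j * u j := by
      rw [Finset.mul_sum]
      exact Finset.sum_congr rfl fun j _ => by ring
    have h2 := (hd i).ne'
    rw [h1]
    simp only [T, LinearMap.coe_mk, AddHom.coe_mk]
    field_simp
    ring
  refine wnorm_apply_le (T := T) (fun i => (hd i).le)
    (rate_pos hκ hK.le_one hlam0 hc0 hη hη') ?_ ?_ ?_ u
  · intro u u'
    have h1 : ∑ i, ∑ j, u' i * u j * K i j = ∑ i, ∑ j, u i * u' j * K i j := by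
      rw [Finset.sum_comm]
      exact Finset.sum_congr rfl fun i _ => Finset.sum_congr rfl fun j _ => by
        rw [hK.symm]; ring
    rw [hT, hT, h1]
    simp only [mul_comm (u' _) (u _)]
  · intro u
    rw [hT]
    have h1 := hK.quadratic_nonneg u
    have h2 : lam0 * (1 - c) * ∑ i, deg K i * u i ^ 2 ≤ ∑ i, γ i * (deg K i * (u i * u i)) := by
      rw [Finset.mul_sum]
      refine Finset.sum_le_sum fun i _ => ?_
      rw [← pow_two]
      exact mul_le_mul_of_nonneg_right (hγ i) (mul_nonneg (hd i).le (sq_nonneg _))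
    have h3 := mul_le_mul_of_nonneg_left h2 hη.le
    have h4 := mul_nonneg hη.le h1
    simp only [← pow_two] at h3 ⊢
    linarith
  · intro u
    rw [hT]
    have h1 := hK.quadratic_le hκ.le u
    have h2 : ∑ i, γ i * (deg K i * (u i * u i)) ≤
        (lam0 / κ + lam0 * c) * ∑ i, deg K i * u i ^ 2 := by
      rw [Finset.mul_sum]
      refine Finset.sum_le_sum fun i _ => ?_
      rw [← pow_two]
      exact mul_le_mul_of_nonneg_right (hγ' i) (mul_nonneg (hd i).le (sq_nonneg _))
    have h3 := mul_le_mul_of_nonneg_left h2 hη.le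
    have h4 := mul_le_mul_of_nonneg_left h1 hη.le
    have h0 : 0 ≤ ∑ i, deg K i * u i ^ 2 :=
      Finset.sum_nonneg fun i _ => mul_nonneg (hd i).le (sq_nonneg _)
    -- The lower bound requires η(1 + λ₀/κ + λ₀c) ≤ 2 - ηλ₀(1 - c). The terms in c cancel, and what
    -- is left is exactly the condition on η.
    rw [le_div_iff₀ (by positivity)] at hη'
    have h5 := mul_le_mul_of_nonneg_right hη' h0
    simp only [← pow_two] at h3 ⊢
    linarith

/-- One step of the perturbed iteration. -/
theorem IsKernel.wnorm_step_le [Nonempty ι] {K : ι → ι → ℝ} {κ : ℝ} (hK : IsKernel K κ)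
    {lam0 c η ε By τ : ℝ} (hκ : 0 < κ) (hlam0 : 0 < lam0) (hε : 0 < ε) (hεc : ε ≤ c)
    (hη : 0 < η) (hη' : η ≤ 2 / (1 + lam0 + lam0 / κ)) (hBy : 0 ≤ By) (hτ : 0 ≤ τ)
    {α y wstar w w' : ι → ℝ} (hα : ∀ i, |1 / deg K i - α i| ≤ ε / Fintype.card ι)
    (hy : ∀ i, |y i| ≤ By)
    (hw : ∀ i, ∑ j, K i j * wstar j + Fintype.card ι * lam0 * wstar i = y i)
    (hw' : ∀ i, |w' i - (w i - η * (Fintype.card ι * lam0) * (α i * w i) + η * (y i * α i) -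
      η * ((∑ j, K i j * w j) / deg K i))| ≤ η * τ / Fintype.card ι) :
    wnorm (deg K) (fun i => w' i - wstar i) ≤
      (1 - η * lam0 * (1 - c)) * wnorm (deg K) (fun i => w i - wstar i) +
        η * (By / √lam0 * ε + τ) := by
  have hN : (0 : ℝ) < Fintype.card ι := by exact_mod_cast Fintype.card_pos
  have hd := hK.deg_pos hκ
  have hdN := hK.deg_le
  have hdκ := hK.le_deg
  set N : ℝ := (Fintype.card ι : ℝ) with hN_def
  have hγ : ∀ i, |N * lam0 / deg K i - N * lam0 * α i| ≤ lam0 * ε := by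
    intro i
    have e : N * lam0 / deg K i - N * lam0 * α i = N * lam0 * (1 / deg K i - α i) := by ring
    rw [e, abs_mul, abs_of_pos (by positivity)]
    calc N * lam0 * |1 / deg K i - α i| ≤ N * lam0 * (ε / N) := by gcongr; exact hα i
      _ = lam0 * ε := by field_simp
  have hγ1 : ∀ i, lam0 * (1 - c) ≤ N * lam0 * α i := by
    intro i
    have h1 := (abs_le.1 (hγ i)).2
    have h2 : lam0 ≤ N * lam0 / deg K i := by
      rw [le_div_iff₀ (hd i)]
      nlinarith [hdN i]
    nlinarith
  have hγ2 : ∀ i, N * lam0 * α i ≤ lam0 / κ + lam0 * c := by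
    intro i
    have h1 := (abs_le.1 (hγ i)).1
    have h2 : N * lam0 / deg K i ≤ lam0 / κ := by
      rw [div_le_div_iff₀ (hd i) hκ]
      nlinarith [hdκ i]
    nlinarith
  set u : ι → ℝ := fun i => w i - wstar i with hu
  have hcon := hK.contraction hκ hlam0 (hε.trans_le hεc) hη hη' hγ1 hγ2 u
  set r : ι → ℝ := fun i => w' i - wstar i -
    (u i - η * ((∑ j, K i j * u j) / deg K i + N * lam0 * α i * u i)) with hr
  have hrb : ∀ i, |r i| ≤ η * (By / √lam0 * ε + τ) / N := by
    intro i
    have h1 : ∑ j, K i j * u j = ∑ j, K i j * w j - ∑ j, K i j * wstar j := by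
      simp only [hu, mul_sub, Finset.sum_sub_distrib]
    -- The same α multiplies y and the regularization term, so inserting y = Kw* + λw* cancels the
    -- contributions of λw*. Only (1/deg - α)Kw* survives, and Kw* is bounded uniformly in N.
    have h2 : r i = (w' i - (w i - η * (N * lam0) * (α i * w i) + η * (y i * α i) -
        η * ((∑ j, K i j * w j) / deg K i))) +
        -(η * ((1 / deg K i - α i) * ∑ j, K i j * wstar j)) := by
      simp only [hr]
      rw [h1, ← hw i]
      simp only [hu]
      ring
    have h3 : |-(η * ((1 / deg K i - α i) * ∑ j, K i j * wstar j))| ≤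
        η * (ε / N * (By / √lam0)) := by
      rw [abs_neg, abs_mul, abs_mul, abs_of_pos hη]
      have := hK.abs_fit_le hlam0 hBy hy hw i
      gcongr
      exact hα i
    rw [h2]
    refine (abs_add_le _ _).trans ((add_le_add (hw' i) h3).trans_eq ?_)
    ring
  have hsplit : (fun i => w' i - wstar i) = fun i =>
      (u i - η * ((∑ j, K i j * u j) / deg K i + N * lam0 * α i * u i)) + r i := by
    funext i
    simp only [hr]
    ring
  rw [hsplit]
  refine (wnorm_add_le (fun i => (hd i).le) _ _).trans (add_le_add hcon ?_)
  refine (wnorm_le_of_abs_le hdN hrb (by positivity)).trans_eq ?_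
  rw [← hN_def]
  field_simp

/-- A single term of the weighted sum is at least N κ u_i². -/
theorem IsKernel.abs_le_wnorm [Nonempty ι] {K : ι → ι → ℝ} {κ : ℝ} (hK : IsKernel K κ)
    (hκ : 0 < κ) (u : ι → ℝ) (i : ι) :
    |u i| ≤ wnorm (deg K) u / √κ / √(Fintype.card ι) := by
  have hN : (0 : ℝ) < Fintype.card ι := by exact_mod_cast Fintype.card_pos
  have hd := hK.deg_pos hκ
  refine abs_le_of_sq_le_sq ?_ (by have := wnorm_nonneg (deg K) u; positivity)
  rw [div_pow, div_pow, Real.sq_sqrt hκ.le, Real.sq_sqrt hN.le, wnorm_sq fun i => (hd i).le,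
    le_div_iff₀ hN, le_div_iff₀ hκ]
  have h1 : deg K i * u i ^ 2 ≤ ∑ i, deg K i * u i ^ 2 :=
    Finset.single_le_sum (f := fun i => deg K i * u i ^ 2)
      (fun j _ => mul_nonneg (hd j).le (sq_nonneg _)) (Finset.mem_univ i)
  nlinarith [mul_le_mul_of_nonneg_right (hK.le_deg i) (sq_nonneg (u i))]

/-- Cauchy–Schwarz loses √N, and the lower bound N κ on the weights gains it back; the prediction
error is thus free of N. -/
theorem IsKernel.abs_sum_mul_le_wnorm [Nonempty ι] {K : ι → ι → ℝ} {κ : ℝ} (hK : IsKernel K κ)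
    (hκ : 0 < κ) (u k : ι → ℝ) (hk0 : ∀ i, 0 ≤ k i) (hk1 : ∀ i, k i ≤ 1) :
    |∑ i, u i * k i| ≤ wnorm (deg K) u / √κ := by
  have hN : (0 : ℝ) < Fintype.card ι := by exact_mod_cast Fintype.card_pos
  have hd := hK.deg_pos hκ
  refine abs_le_of_sq_le_sq ?_ (by have := wnorm_nonneg (deg K) u; positivity)
  rw [div_pow, Real.sq_sqrt hκ.le, wnorm_sq fun i => (hd i).le, le_div_iff₀ hκ]
  have h1 : (∑ i, u i * k i) ^ 2 ≤ Fintype.card ι * ∑ i, u i ^ 2 := by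
    refine (sq_sum_le_card_mul_sum_sq (s := Finset.univ) (f := fun i => u i * k i)).trans ?_
    rw [Finset.card_univ]
    refine mul_le_mul_of_nonneg_left (Finset.sum_le_sum fun i _ => ?_) hN.le
    have : k i ^ 2 ≤ 1 := by nlinarith [hk0 i, hk1 i]
    nlinarith [sq_nonneg (u i)]
  have h2 : Fintype.card ι * κ * ∑ i, u i ^ 2 ≤ ∑ i, deg K i * u i ^ 2 := by
    rw [Finset.mul_sum]
    exact Finset.sum_le_sum fun i _ => mul_le_mul_of_nonneg_right (hK.le_deg i) (sq_nonneg _)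
  nlinarith

end Richardson

/-! The action of the layers on the slots. -/

theorem sum_slot (f : Slot → ℝ) : ∑ r, f r = f .y + f .w + f .sqNorm + f .k + f .alpha + f .beta +
    f .p + f .khat + f .s + f .t + f .one := by
  have h : (Finset.univ : Finset Slot) = {Slot.y, Slot.w, Slot.sqNorm, Slot.k, Slot.alpha,
    Slot.beta, Slot.p, Slot.khat, Slot.s, Slot.t, Slot.one} := rfl
  rw [h]
  simp [Finset.sum_insert]
  ring

theorem coord_dotProduct {d : ℕ} (r : Slot) (z : Feature d → ℝ) :
    coord r ⬝ᵥ z = z (Sum.inr r) := by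
  simp [coord]

theorem headMatrix_dotProduct {d : ℕ} (v : ℝ) (u u' q q' z z' : Feature d → ℝ) :
    (headMatrix v u u' *ᵥ z) ⬝ᵥ (headMatrix v q q' *ᵥ z') =
      (∑ a, z (Sum.inl a) * z' (Sum.inl a)) / v ^ 2 + (u ⬝ᵥ z) * (q ⬝ᵥ z') +
        (u' ⬝ᵥ z) * (q' ⬝ᵥ z') := by
  have e : ∀ (u u' z : Feature d → ℝ) (r : Feature d), (headMatrix v u u' *ᵥ z) r = match r with
      | Sum.inl a => 1 / v * z (Sum.inl a)
      | Sum.inr Slot.y => u ⬝ᵥ z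
      | Sum.inr Slot.w => u' ⬝ᵥ z
      | Sum.inr _ => 0 := by
    rintro u u' z (a | r)
    · simp only [headMatrix, Matrix.mulVec, Matrix.of_apply, smul_dotProduct, smul_eq_mul,
        single_dotProduct, one_mul]
    · cases r <;> simp [headMatrix, Matrix.mulVec]
  rw [dotProduct, Fintype.sum_sum_type, sum_slot]
  simp only [e, Finset.sum_div, mul_zero, add_zero, add_assoc]
  congr 1
  exact Finset.sum_congr rfl fun a _ => by ring

theorem Attention.score_colMask {d n : ℕ} {v : ℝ} {u u' q q' : Feature d → ℝ}
    {V : Matrix (Feature d) (Feature d) ℝ} {P : Fin n → Prop} [DecidablePred P]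
    (Z : Matrix (Feature d) (Fin n) ℝ) (i j : Fin n) :
    Attention.score ⟨headMatrix v u u', headMatrix v q q', V, colMask P⟩ Z i j =
      if P j then 0 else
        Real.exp ((∑ a, Z (Sum.inl a) i * Z (Sum.inl a) j) / v ^ 2 +
          (u ⬝ᵥ Z.col i) * (q ⬝ᵥ Z.col j) + (u' ⬝ᵥ Z.col i) * (q' ⬝ᵥ Z.col j)) := by
  simp only [Attention.score, headMatrix_dotProduct, colMask, Matrix.of_apply, Matrix.col_apply]
  split_ifs
  · simp
  · rw [add_zero, EReal.exp_coe]
    exact ENNReal.toReal_ofReal (Real.exp_pos _).le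

/-- The state `Z` with the slot `r` overwritten by `g`. -/
def writeSlot {d n : ℕ} (Z : Matrix (Feature d) (Fin n) ℝ) (r : Slot) (g : Fin n → ℝ) :
    Matrix (Feature d) (Fin n) ℝ :=
  Matrix.of fun r' i => if r' = Sum.inr r then g i else Z r' i

theorem writeSlot_apply {d n : ℕ} (Z : Matrix (Feature d) (Fin n) ℝ) (r : Slot) (g : Fin n → ℝ)
    (r' : Feature d) (i : Fin n) :
    writeSlot Z r g r' i = if r' = Sum.inr r then g i else Z r' i := rfl

/-- Attention with a value matrix supported on one row writes to one slot. -/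
theorem Attention.apply_valueMatrix {d n : ℕ} (A : Attention (Feature d) n) {r : Slot}
    {u : Feature d → ℝ} (hA : A.WV = valueMatrix r u) (Z : Matrix (Feature d) (Fin n) ℝ) :
    A.apply Z = writeSlot Z r fun i => Z (Sum.inr r) i +
      (∑ j, A.score Z i j * (u ⬝ᵥ Z.col j)) / ∑ j, A.score Z i j := by
  ext r' i
  rw [writeSlot_apply]
  split_ifs with h
  · subst h
    simp only [Attention.apply, Matrix.of_apply, hA]
    rw [Finset.sum_div]
    congr 1
    refine Finset.sum_congr rfl fun j _ => ?_
    simp [valueMatrix, Matrix.mulVec]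
    ring
  · simp [Attention.apply, hA, valueMatrix, Matrix.mulVec, h]

theorem MLP.mk_apply {d n k : ℕ} (A : Fin k → Feature d → ℝ) (B : Matrix (Feature d) (Fin k) ℝ)
    (Z : Matrix (Feature d) (Fin n) ℝ) (r : Feature d) (i : Fin n) :
    MLP.apply ⟨k, Matrix.of A, B⟩ Z r i = Z r i + ∑ s, B r s * relu (A s ⬝ᵥ Z.col i) := rfl

theorem outRow_apply {d n : ℕ} (r : Slot) (c : Fin n → ℝ) (r' : Feature d) (s : Fin n) :
    outRow r c r' s = if r' = Sum.inr r then c s else 0 := rfl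

theorem evalMLP_apply {d n : ℕ} (φ : ReluNet) (u : Feature d → ℝ) (r : Slot)
    {Z : Matrix (Feature d) (Fin n) ℝ} (hZ : ∀ i, Z (Sum.inr Slot.one) i = 1) :
    (evalMLP φ u r).apply Z = writeSlot Z r fun i =>
      Z (Sum.inr r) i + φ.eval (u ⬝ᵥ Z.col i) := by
  ext r' i
  rw [evalMLP, MLP.mk_apply, writeSlot_apply]
  split_ifs with h
  · subst h
    simp [outRow_apply, ReluNet.eval, add_dotProduct, coord_dotProduct, Matrix.col_apply, hZ]
  · simp [outRow_apply, h]

theorem clearMLP_apply {d n : ℕ} (r : Slot) (B : ℝ)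
    {Z : Matrix (Feature d) (Fin n) ℝ} (hZ : ∀ i, Z (Sum.inr Slot.one) i = 1) :
    (clearMLP d r B).apply Z = writeSlot Z r fun i =>
      Z (Sum.inr r) i + (relu (-Z (Sum.inr r) i - B * (1 - Z (Sum.inr Slot.t) i)) -
        relu (Z (Sum.inr r) i - B * (1 - Z (Sum.inr Slot.t) i))) := by
  ext r' i
  rw [clearMLP, MLP.mk_apply, writeSlot_apply]
  split_ifs with h
  · subst h
    simp only [outRow_apply, if_true, Fin.sum_univ_two, Matrix.cons_val_zero, Matrix.cons_val_one,
      sub_dotProduct, neg_dotProduct, smul_dotProduct, coord_dotProduct, Matrix.col_apply, hZ,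
      smul_eq_mul]
    ring
  · simp [outRow_apply, h]

theorem productMLP_apply {d n : ℕ} (φ : ReluNet) (m : ℝ) (u u' : Feature d → ℝ) (r : Slot)
    {Z : Matrix (Feature d) (Fin n) ℝ} (hZ : ∀ i, Z (Sum.inr Slot.one) i = 1) :
    (productMLP φ m u u' r).apply Z = writeSlot Z r fun i =>
      Z (Sum.inr r) i + m * (φ.eval (u ⬝ᵥ Z.col i + u' ⬝ᵥ Z.col i) -
        φ.eval (u ⬝ᵥ Z.col i - u' ⬝ᵥ Z.col i)) := by
  ext r' i
  rw [productMLP, MLP.mk_apply, writeSlot_apply]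
  split_ifs with h
  · subst h
    simp only [outRow_apply, if_true, Fin.sum_univ_add, ReluNet.eval, add_dotProduct,
      sub_dotProduct, smul_dotProduct, coord_dotProduct, Matrix.col_apply, hZ, smul_eq_mul,
      Pi.smul_apply, Pi.neg_apply, Fin.append_left, Fin.append_right, mul_one]
    simp only [mul_assoc, neg_mul, mul_neg, Finset.sum_neg_distrib, ← Finset.mul_sum]
    ring
  · simp [outRow_apply, h]

theorem stepMLP_apply {d n : ℕ} (η lam : ℝ) (φ : ReluNet)
    {Z : Matrix (Feature d) (Fin n) ℝ} (hZ : ∀ i, Z (Sum.inr Slot.one) i = 1) :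
    (stepMLP d η lam φ).apply Z = writeSlot (writeSlot Z Slot.w fun i =>
      Z (Sum.inr Slot.w) i - η * lam / 4 *
        (φ.eval (Z (Sum.inr Slot.w) i + Z (Sum.inr Slot.alpha) i) -
          φ.eval (Z (Sum.inr Slot.w) i - Z (Sum.inr Slot.alpha) i)) +
        Z (Sum.inr Slot.beta) i + η * Z (Sum.inr Slot.p) i) Slot.p fun _ => 0 := by
  ext r' i
  rw [stepMLP, MLP.mk_apply, writeSlot_apply]
  have hβ := relu_sub_relu_neg (Z (Sum.inr Slot.beta) i)
  have hp := relu_sub_relu_neg (Z (Sum.inr Slot.p) i)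
  split_ifs with h
  · subst h
    simp [outRow_apply, Fin.sum_univ_add, Fin.sum_univ_four, neg_dotProduct, coord_dotProduct,
      Matrix.col_apply]
    linarith
  rw [writeSlot_apply]
  split_ifs with h'
  · subst h'
    simp only [Matrix.add_apply, outRow_apply, h, if_true, if_false, add_zero, Fin.sum_univ_add,
      Fin.sum_univ_four, ReluNet.eval, add_dotProduct, sub_dotProduct, neg_dotProduct,
      smul_dotProduct, coord_dotProduct, Matrix.col_apply, hZ, smul_eq_mul, Pi.smul_apply,
      Pi.neg_apply, Fin.append_left, Fin.append_right, mul_one, mul_assoc, neg_mul,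
      Finset.sum_neg_distrib, ← Finset.mul_sum, Matrix.cons_val]
    linear_combination hβ + η * hp
  · simp [outRow_apply, h, h']

/-! The states of the network. -/

/-- The column of the `j`-th training token. -/
def trainCol {N : ℕ} (j : Fin N) : Fin (N + 2) := j.castSucc.succ

theorem trainCol_ne_zero {N : ℕ} (j : Fin N) : trainCol j ≠ 0 := Fin.succ_ne_zero _

theorem trainCol_ne_last {N : ℕ} (j : Fin N) : trainCol j ≠ Fin.last (N + 1) := by
  rw [trainCol, ← Fin.succ_last, Ne, Fin.succ_inj]
  exact (Fin.castSucc_lt_last j).ne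

theorem sum_tokens {N : ℕ} (f : Fin (N + 2) → ℝ) :
    ∑ j, f j = f 0 + ∑ j : Fin N, f (trainCol j) + f (Fin.last (N + 1)) := by
  rw [Fin.sum_univ_succ, Fin.sum_univ_castSucc, ← add_assoc]
  rfl

/-- The positions of all tokens. -/
noncomputable def tokenPos {d N : ℕ} (x : Fin N → EuclideanSpace ℝ (Fin d))
    (xtest : EuclideanSpace ℝ (Fin d)) : Fin (N + 2) → EuclideanSpace ℝ (Fin d) :=
  Fin.cons 0 (Fin.snoc x xtest)

section

variable {d N : ℕ} {x : Fin N → EuclideanSpace ℝ (Fin d)} {xtest : EuclideanSpace ℝ (Fin d)}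

theorem tokenPos_zero : tokenPos x xtest 0 = 0 := rfl

theorem tokenPos_train (j : Fin N) : tokenPos x xtest (trainCol j) = x j := by
  simp [tokenPos, trainCol]

theorem tokenPos_last : tokenPos x xtest (Fin.last (N + 1)) = xtest := by
  rw [← Fin.succ_last, tokenPos, Fin.cons_succ, Fin.snoc_last]

theorem prompt_zero {y : Fin N → ℝ} (r : Feature d) :
    prompt x y xtest r 0 = token 0 0 1 0 r := rfl

theorem prompt_train {y : Fin N → ℝ} (r : Feature d) (j : Fin N) :
    prompt x y xtest r (trainCol j) = token (x j) (y j) 0 0 r := by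
  simp [prompt, trainCol]

theorem prompt_last {y : Fin N → ℝ} (r : Feature d) :
    prompt x y xtest r (Fin.last (N + 1)) = token xtest 0 0 1 r := by
  rw [← Fin.succ_last, prompt, Matrix.of_apply, Fin.cons_succ, Fin.snoc_last]

theorem col_cases {P : Fin (N + 2) → Prop} (h0 : P 0) (h1 : ∀ j, P (trainCol j))
    (h2 : P (Fin.last (N + 1))) (i : Fin (N + 2)) : P i := by
  refine Fin.cases h0 (fun i => ?_) i
  refine Fin.lastCases (by rwa [Fin.succ_last]) (fun j => h1 j) i

variable (x xtest) in
/-- The slots that the network never changes still carry the tokens of the prompt. -/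
structure HasTokens (Z : Matrix (Feature d) (Fin (N + 2)) ℝ) : Prop where
  pos : ∀ i a, Z (Sum.inl a) i = tokenPos x xtest i a
  sqNorm : ∀ i, Z (Sum.inr Slot.sqNorm) i = ‖tokenPos x xtest i‖ ^ 2
  one : ∀ i, Z (Sum.inr Slot.one) i = 1
  s_zero : Z (Sum.inr Slot.s) 0 = 1
  s_train : ∀ j, Z (Sum.inr Slot.s) (trainCol j) = 0
  s_test : Z (Sum.inr Slot.s) (Fin.last (N + 1)) = 0
  t_train : ∀ j, Z (Sum.inr Slot.t) (trainCol j) = 0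
  t_test : Z (Sum.inr Slot.t) (Fin.last (N + 1)) = 1

theorem hasTokens_prompt (y : Fin N → ℝ) : HasTokens x xtest (prompt x y xtest) where
  pos i a := by
    induction i using col_cases
    · simp [prompt_zero, tokenPos_zero, token]
    · simp [prompt_train, tokenPos_train, token]
    · simp [prompt_last, tokenPos_last, token]
  sqNorm i := by
    induction i using col_cases
    · simp [prompt_zero, tokenPos_zero, token]
    · simp [prompt_train, tokenPos_train, token]
    · simp [prompt_last, tokenPos_last, token]
  one i := by
    induction i using col_cases
    · simp [prompt_zero, token]
    · simp [prompt_train, token]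
    · simp [prompt_last, token]
  s_zero := by simp [prompt_zero, token]
  s_train j := by simp [prompt_train, token]
  s_test := by simp [prompt_last, token]
  t_train j := by simp [prompt_train, token]
  t_test := by simp [prompt_last, token]

variable {Z : Matrix (Feature d) (Fin (N + 2)) ℝ}

theorem HasTokens.writeSlot (hZ : HasTokens x xtest Z) {r : Slot} (h1 : r ≠ .sqNorm)
    (h2 : r ≠ .one) (h3 : r ≠ .s) (h4 : r ≠ .t) (g : Fin (N + 2) → ℝ) :
    HasTokens x xtest (writeSlot Z r g) where
  pos i a := by simp [writeSlot_apply, hZ.pos]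
  sqNorm i := by simp [writeSlot_apply, hZ.sqNorm, h1.symm]
  one i := by simp [writeSlot_apply, hZ.one, h2.symm]
  s_zero := by simp [writeSlot_apply, hZ.s_zero, h3.symm]
  s_train j := by simp [writeSlot_apply, hZ.s_train, h3.symm]
  s_test := by simp [writeSlot_apply, hZ.s_test, h3.symm]
  t_train j := by simp [writeSlot_apply, hZ.t_train, h4.symm]
  t_test := by simp [writeSlot_apply, hZ.t_test, h4.symm]

/-! ### Attention scores and averages on the prompt. -/

theorem exp_inner_eq_gaussKernel {v : ℝ} (hv : 0 < v) (x x' : EuclideanSpace ℝ (Fin d)) :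
    Real.exp ((∑ a, x a * x' a) / v ^ 2 - ‖x‖ ^ 2 / (2 * v ^ 2) - ‖x'‖ ^ 2 / (2 * v ^ 2)) =
      gaussKernel v x x' := by
  rw [gaussKernel, norm_sub_sq_coord]
  congr 1
  field_simp
  ring

theorem HasTokens.kernel_score (hZ : HasTokens x xtest Z) {v : ℝ} (hv : 0 < v)
    {V : Matrix (Feature d) (Feature d) ℝ} {P : Fin (N + 2) → Prop} [DecidablePred P]
    (i j : Fin (N + 2)) :
    Attention.score ⟨headMatrix v ((1 / v) • coord Slot.sqNorm) (-(1 / (2 * v)) • coord Slot.one),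
      headMatrix v (-(1 / (2 * v)) • coord Slot.one) ((1 / v) • coord Slot.sqNorm), V,
      colMask P⟩ Z i j =
      if P j then 0 else gaussKernel v (tokenPos x xtest i) (tokenPos x xtest j) := by
  rw [Attention.score_colMask, ← exp_inner_eq_gaussKernel hv]
  simp only [smul_dotProduct, coord_dotProduct, Matrix.col_apply, hZ.pos, hZ.sqNorm, hZ.one,
    smul_eq_mul]
  congr 2
  field_simp
  ring

/-- The factor 1 - s removes the query's squared norm when the key is the dummy, whose position is
0; its exponent is therefore 0 rather than -‖x_i‖²/(2v²). -/
theorem HasTokens.readIn_score (hZ : HasTokens x xtest Z) {v : ℝ} (hv : 0 < v)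
    {i : Fin (N + 2)} (hi : Z (Sum.inr Slot.s) i = 0) (j : Fin (N + 2)) :
    (readInAttention d N v).score Z i j = if j = Fin.last (N + 1) then 0 else if j = 0 then 1 else
      gaussKernel v (tokenPos x xtest i) (tokenPos x xtest j) := by
  rw [readInAttention, Attention.score_colMask]
  refine if_congr Iff.rfl rfl ?_
  simp only [smul_dotProduct, sub_dotProduct, coord_dotProduct, Matrix.col_apply, hZ.pos,
    hZ.sqNorm, hZ.one, smul_eq_mul, hi]
  by_cases h : j = 0
  · subst h
    simp [tokenPos_zero, hZ.s_zero]
  by_cases h' : j = Fin.last (N + 1)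
  · subst h'
    rw [if_neg h, ← exp_inner_eq_gaussKernel hv, hZ.s_test]
    congr 1
    field_simp
    ring
  · have h0 : Z (Sum.inr Slot.s) j = 0 :=
      col_cases (P := fun j => j ≠ 0 → j ≠ Fin.last (N + 1) → Z (Sum.inr Slot.s) j = 0)
        (fun h => absurd rfl h) (fun j _ _ => hZ.s_train j) (fun _ h => absurd rfl h) j h h'
    rw [if_neg h, ← exp_inner_eq_gaussKernel hv, h0]
    congr 1
    field_simp
    ring

/-- The read-in attention writes `1 / (1 + ∑ j, K(x_i, x_j))` to the slot `k`. -/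
theorem HasTokens.readIn_average (hZ : HasTokens x xtest Z) {v : ℝ} (hv : 0 < v)
    {i : Fin (N + 2)} (hi : Z (Sum.inr Slot.s) i = 0) :
    (∑ j, (readInAttention d N v).score Z i j * (coord Slot.s ⬝ᵥ Z.col j)) /
      ∑ j, (readInAttention d N v).score Z i j =
      1 / (1 + ∑ j, gaussKernel v (tokenPos x xtest i) (x j)) := by
  have h0 : (0 : Fin (N + 2)) ≠ Fin.last (N + 1) := (Fin.last_pos).ne
  simp only [hZ.readIn_score hv hi, coord_dotProduct, Matrix.col_apply, sum_tokens,
    trainCol_ne_zero, trainCol_ne_last, if_true, if_false, h0, hZ.s_zero, hZ.s_train,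
    tokenPos_train, mul_zero, Finset.sum_const_zero, zero_mul, add_zero, mul_one]

theorem HasTokens.iter_average (hZ : HasTokens x xtest Z) {v : ℝ} (hv : 0 < v)
    (i : Fin (N + 2)) :
    (∑ j, (iterAttention d N v).score Z i j * (-coord Slot.w ⬝ᵥ Z.col j)) /
      ∑ j, (iterAttention d N v).score Z i j =
      -((∑ j, gaussKernel v (tokenPos x xtest i) (x j) * Z (Sum.inr Slot.w) (trainCol j)) /
        ∑ j, gaussKernel v (tokenPos x xtest i) (x j)) := by
  have h0 : (0 : Fin (N + 2)) ≠ Fin.last (N + 1) := (Fin.last_pos).ne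
  simp only [iterAttention, hZ.kernel_score hv, neg_dotProduct, coord_dotProduct,
    Matrix.col_apply, sum_tokens, trainCol_ne_zero, trainCol_ne_last, if_true, if_false, true_or,
    or_true, or_self, tokenPos_train, mul_neg, Finset.sum_neg_distrib, zero_mul, add_zero,
    zero_add, neg_div]

/-- The test token attends to itself: it adds K = 1 to the denominator and, as w vanishes there,
nothing to the numerator. The denominator is therefore the reciprocal of the value that the read-in
left in the slot `k`. -/
theorem HasTokens.readOut_average (hZ : HasTokens x xtest Z) {v : ℝ} (hv : 0 < v)
    (hw : Z (Sum.inr Slot.w) (Fin.last (N + 1)) = 0) :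
    (∑ j, (readOutAttention d N v).score Z (Fin.last (N + 1)) j * (coord Slot.w ⬝ᵥ Z.col j)) /
      ∑ j, (readOutAttention d N v).score Z (Fin.last (N + 1)) j =
      (∑ j, gaussKernel v xtest (x j) * Z (Sum.inr Slot.w) (trainCol j)) /
        (1 + ∑ j, gaussKernel v xtest (x j)) := by
  have h0 : Fin.last (N + 1) ≠ 0 := (Fin.last_pos).ne'
  simp only [readOutAttention, hZ.kernel_score hv, coord_dotProduct,
    Matrix.col_apply, sum_tokens, trainCol_ne_zero, if_true, if_false,
    tokenPos_train, zero_mul, zero_add, tokenPos_last, h0, hw, mul_zero, add_zero,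
    gaussKernel_self]
  rw [add_comm (1 : ℝ)]

theorem clear_of_abs_le {a B : ℝ} (h : |a| ≤ B) :
    a + (relu (-a - B * (1 - 0)) - relu (a - B * (1 - 0))) = a := by
  rw [abs_le] at h
  rw [relu_of_nonpos (by linarith), relu_of_nonpos (by linarith)]
  ring

theorem clear_test (a B : ℝ) :
    a + (relu (-a - B * (1 - 1)) - relu (a - B * (1 - 1))) = 0 := by
  have := relu_sub_relu_neg a
  simp only [sub_self, mul_zero, sub_zero]
  linarith

variable (x xtest) in
/-- The state of the network between two iterations, with current iterate `w`. -/
structure IterState (v : ℝ) (α β w : Fin N → ℝ) (Z : Matrix (Feature d) (Fin (N + 2)) ℝ) :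
    Prop where
  tokens : HasTokens x xtest Z
  k_test : Z (Sum.inr Slot.k) (Fin.last (N + 1)) = 1 / (1 + ∑ j, gaussKernel v xtest (x j))
  alpha : ∀ j, Z (Sum.inr Slot.alpha) (trainCol j) = α j
  alpha_test : Z (Sum.inr Slot.alpha) (Fin.last (N + 1)) = 0
  beta : ∀ j, Z (Sum.inr Slot.beta) (trainCol j) = β j
  beta_test : Z (Sum.inr Slot.beta) (Fin.last (N + 1)) = 0
  w : ∀ j, Z (Sum.inr Slot.w) (trainCol j) = w j
  w_test : Z (Sum.inr Slot.w) (Fin.last (N + 1)) = 0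
  p : ∀ j, Z (Sum.inr Slot.p) (trainCol j) = 0
  p_test : Z (Sum.inr Slot.p) (Fin.last (N + 1)) = 0
  y_test : Z (Sum.inr Slot.y) (Fin.last (N + 1)) = 0
  khat_test : Z (Sum.inr Slot.khat) (Fin.last (N + 1)) = 0

/-! ### Read-in, iteration and read-out as maps between states. -/

theorem runBlocks_append {F : Type} [Fintype F] {n : ℕ} (L L' : List (Block F n))
    (Z : Matrix F (Fin n) ℝ) : runBlocks (L ++ L') Z = runBlocks L' (runBlocks L Z) :=
  List.foldl_append ..

theorem iterState_readIn {v : ℝ} (hv : 0 < v) {η Bα : ℝ} {Φ : Approximants} {y : Fin N → ℝ}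
    {α : Fin N → ℝ} (hα : ∀ i, α i = Φ.flip.eval (1 / (1 + ∑ j, gaussKernel v (x i) (x j))))
    (hαB : ∀ i, |α i| ≤ Bα) :
    IterState x xtest v α (fun i => η / 4 * (Φ.sq.eval (y i + α i) - Φ.sq.eval (y i - α i)))
      (fun _ => 0) (runBlocks (readInBlocks d N v η Bα Φ) (prompt x y xtest)) := by
  have h0 := hasTokens_prompt (x := x) (xtest := xtest) y
  set Z := prompt x y xtest with hZ
  have hZlast : ∀ r, Z r (Fin.last (N + 1)) = token xtest 0 0 1 r := fun r => prompt_last r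
  have hZtrain : ∀ r j, Z r (trainCol j) = token (x j) (y j) 0 0 r := fun r j => prompt_train r j
  simp only [runBlocks, readInBlocks, List.foldl_cons, List.foldl_nil, Block.apply]
  rw [Attention.apply_valueMatrix (readInAttention d N v) rfl]
  have h1 := h0.writeSlot (r := .k) (by decide) (by decide) (by decide) (by decide) fun i =>
    Z (Sum.inr Slot.k) i + (∑ j, (readInAttention d N v).score Z i j * (coord Slot.s ⬝ᵥ Z.col j)) /
      ∑ j, (readInAttention d N v).score Z i j
  set Z1 := writeSlot Z Slot.k _ with hZ1
  have k_test : Z1 (Sum.inr Slot.k) (Fin.last (N + 1)) =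
      1 / (1 + ∑ j, gaussKernel v xtest (x j)) := by
    rw [hZ1, writeSlot_apply, if_pos rfl, h0.readIn_average hv h0.s_test, tokenPos_last, hZlast]
    exact zero_add _
  have k_train : ∀ i, Z1 (Sum.inr Slot.k) (trainCol i) =
      1 / (1 + ∑ j, gaussKernel v (x i) (x j)) := by
    intro i
    rw [hZ1, writeSlot_apply, if_pos rfl, h0.readIn_average hv (h0.s_train i), tokenPos_train,
      hZtrain]
    exact zero_add _
  have hne : ∀ r i, r ≠ Slot.k → Z1 (Sum.inr r) i = Z (Sum.inr r) i := by
    intro r i hr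
    rw [hZ1, writeSlot_apply, if_neg (by simpa using hr)]
  clear_value Z1
  have h2 := fun g => h1.writeSlot (r := .alpha) (by decide) (by decide) (by decide) (by decide) g
  rw [evalMLP_apply _ _ _ h1.one]
  set Z2 := writeSlot Z1 Slot.alpha _ with hZ2
  have h2' : HasTokens x xtest Z2 := h2 _
  have alpha2 : ∀ i, Z2 (Sum.inr Slot.alpha) i = Z1 (Sum.inr Slot.alpha) i +
      Φ.flip.eval (Z1 (Sum.inr Slot.k) i) := by
    intro i
    rw [hZ2, writeSlot_apply, if_pos rfl, coord_dotProduct, Matrix.col_apply]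
  have hne2 : ∀ r i, r ≠ Slot.alpha → Z2 (Sum.inr r) i = Z1 (Sum.inr r) i := by
    intro r i hr
    rw [hZ2, writeSlot_apply, if_neg (by simpa using hr)]
  clear_value Z2
  have h3 := fun g => h2'.writeSlot (r := .alpha) (by decide) (by decide) (by decide) (by decide) g
  rw [clearMLP_apply _ _ h2'.one]
  set Z3 := writeSlot Z2 Slot.alpha _ with hZ3
  have h3' : HasTokens x xtest Z3 := h3 _
  have alpha_train : ∀ i, Z3 (Sum.inr Slot.alpha) (trainCol i) = α i := by
    intro i
    have e : Z2 (Sum.inr Slot.alpha) (trainCol i) = α i := by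
      rw [alpha2, hne _ _ (by decide), hZtrain, k_train, hα]
      exact zero_add _
    rw [hZ3, writeSlot_apply, if_pos rfl, h2'.t_train, e, clear_of_abs_le (hαB i)]
  have alpha_test : Z3 (Sum.inr Slot.alpha) (Fin.last (N + 1)) = 0 := by
    rw [hZ3, writeSlot_apply, if_pos rfl, h2'.t_test, clear_test]
  have hne3 : ∀ r i, r ≠ Slot.k → r ≠ Slot.alpha → Z3 (Sum.inr r) i = Z (Sum.inr r) i := by
    intro r i hr hr'
    rw [hZ3, writeSlot_apply, if_neg (by simpa using hr'), hne2 r i hr', hne r i hr]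
  have k_test3 : Z3 (Sum.inr Slot.k) (Fin.last (N + 1)) =
      1 / (1 + ∑ j, gaussKernel v xtest (x j)) := by
    rw [hZ3, writeSlot_apply, if_neg (by simp), hne2 _ _ (by decide), k_test]
  clear_value Z3
  have h4 := fun g => h3'.writeSlot (r := .beta) (by decide) (by decide) (by decide) (by decide) g
  rw [productMLP_apply _ _ _ _ _ h3'.one]
  constructor
  · exact h4 _
  all_goals simp [writeSlot_apply, coord_dotProduct, Matrix.col_apply, alpha_train, alpha_test,
    k_test3, hne3, hZlast, hZtrain, token]

/-- Allowing s to exceed the sum of the weights covers both the iteration, where s = ∑ k, and the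
read-out, where s = 1 + ∑ k. -/
theorem abs_weighted_average_le {ι : Type*} [Fintype ι] {k w : ι → ℝ} {B s : ℝ}
    (hk : ∀ i, 0 ≤ k i) (hs : ∑ i, k i ≤ s) (hs0 : 0 < s) (hB : 0 ≤ B) (hw : ∀ i, |w i| ≤ B) :
    |(∑ i, k i * w i) / s| ≤ B := by
  rw [abs_div, abs_of_pos hs0, div_le_iff₀ hs0]
  calc |∑ i, k i * w i| ≤ ∑ i, |k i * w i| := Finset.abs_sum_le_sum_abs _ _
    _ ≤ ∑ i, k i * B := Finset.sum_le_sum fun i _ => by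
        rw [abs_mul, abs_of_nonneg (hk i)]
        exact mul_le_mul_of_nonneg_left (hw i) (hk i)
    _ = (∑ i, k i) * B := (Finset.sum_mul ..).symm
    _ ≤ s * B := by gcongr
    _ = B * s := mul_comm _ _

/-- The attention output is an average of the w_j, so `hw` keeps it within the threshold `Bw` and
the clearing layer leaves training tokens alone. At the test token α = 0 makes the two network
values in the product cancel exactly, whatever the value at 0, so w stays 0 there. -/
theorem IterState.iterate {v : ℝ} (hv : 0 < v) {η lam Bw : ℝ} {Φ : Approximants}
    {α β w : Fin N → ℝ} (hZ : IterState x xtest v α β w Z) (hBw : 0 ≤ Bw)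
    (hw : ∀ i, |w i| ≤ Bw) :
    IterState x xtest v α β
      (fun i => w i - η * lam / 4 * (Φ.sqIter.eval (w i + α i) - Φ.sqIter.eval (w i - α i)) + β i +
        η * -((∑ j, gaussKernel v (x i) (x j) * w j) / ∑ j, gaussKernel v (x i) (x j)))
      (runBlocks (iterBlocks d N v η lam Bw Φ) Z) := by
  have h0 := hZ.tokens
  simp only [runBlocks, iterBlocks, List.foldl_cons, List.foldl_nil, Block.apply]
  have h1 := fun g => h0.writeSlot (r := .p) (by decide) (by decide) (by decide) (by decide) g
  rw [Attention.apply_valueMatrix (iterAttention d N v) rfl]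
  set Z1 := writeSlot Z Slot.p _ with hZ1
  have h1' : HasTokens x xtest Z1 := h1 _
  have p1 : ∀ i, Z1 (Sum.inr Slot.p) (trainCol i) =
      -((∑ j, gaussKernel v (x i) (x j) * w j) / ∑ j, gaussKernel v (x i) (x j)) := by
    intro i
    rw [hZ1, writeSlot_apply, if_pos rfl, hZ.p, h0.iter_average hv, tokenPos_train, zero_add]
    simp only [hZ.w]
  have hne1 : ∀ r i, r ≠ Slot.p → Z1 (Sum.inr r) i = Z (Sum.inr r) i := by
    intro r i hr
    rw [hZ1, writeSlot_apply, if_neg (by simpa using hr)]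
  clear_value Z1
  have h2 := fun g => h1'.writeSlot (r := .p) (by decide) (by decide) (by decide) (by decide) g
  rw [clearMLP_apply _ _ h1'.one]
  set Z2 := writeSlot Z1 Slot.p _ with hZ2
  have h2' : HasTokens x xtest Z2 := h2 _
  have p2 : ∀ i, Z2 (Sum.inr Slot.p) (trainCol i) =
      -((∑ j, gaussKernel v (x i) (x j) * w j) / ∑ j, gaussKernel v (x i) (x j)) := by
    intro i
    rw [hZ2, writeSlot_apply, if_pos rfl, h1'.t_train, p1, clear_of_abs_le]
    rw [abs_neg]
    exact abs_weighted_average_le (fun j => (gaussKernel_pos _ _ _).le) le_rfl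
      (Finset.sum_pos (fun j _ => gaussKernel_pos _ _ _) ⟨i, Finset.mem_univ i⟩) hBw hw
  have p2_test : Z2 (Sum.inr Slot.p) (Fin.last (N + 1)) = 0 := by
    rw [hZ2, writeSlot_apply, if_pos rfl, h1'.t_test, clear_test]
  have hne2 : ∀ r i, r ≠ Slot.p → Z2 (Sum.inr r) i = Z (Sum.inr r) i := by
    intro r i hr
    rw [hZ2, writeSlot_apply, if_neg (by simpa using hr), hne1 r i hr]
  clear_value Z2
  have h3 := fun g => h2'.writeSlot (r := .w) (by decide) (by decide) (by decide) (by decide) g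
  have h4 := fun g g' =>
    (h3 g).writeSlot (r := .p) (by decide) (by decide) (by decide) (by decide) g'
  rw [stepMLP_apply _ _ _ h2'.one]
  constructor
  · exact h4 _ _
  all_goals simp [writeSlot_apply, p2, p2_test, hne2, hZ.k_test, hZ.alpha, hZ.alpha_test, hZ.beta,
    hZ.beta_test, hZ.w, hZ.w_test, hZ.y_test, hZ.khat_test]

theorem IterState.readout_readOut {v : ℝ} (hv : 0 < v) {Φ : Approximants}
    {α β w : Fin N → ℝ} (hZ : IterState x xtest v α β w Z) {kh p : ℝ}
    (hk : kh = Φ.inv.eval (1 / (1 + ∑ j, gaussKernel v xtest (x j))))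
    (hp : p = (∑ j, gaussKernel v xtest (x j) * w j) / (1 + ∑ j, gaussKernel v xtest (x j))) :
    readout (runBlocks (readOutBlocks d N v Φ) Z) =
      N / 4 * (Φ.sqOut.eval (1 / N * kh + p) - Φ.sqOut.eval (1 / N * kh - p)) := by
  have h0 := hZ.tokens
  simp only [runBlocks, readOutBlocks, List.foldl_cons, List.foldl_nil, Block.apply]
  have h1 := fun g => h0.writeSlot (r := .p) (by decide) (by decide) (by decide) (by decide) g
  rw [Attention.apply_valueMatrix (readOutAttention d N v) rfl]
  set Z1 := writeSlot Z Slot.p _ with hZ1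
  have h1' : HasTokens x xtest Z1 := h1 _
  have p1 : Z1 (Sum.inr Slot.p) (Fin.last (N + 1)) = p := by
    rw [hZ1, writeSlot_apply, if_pos rfl, hZ.p_test, h0.readOut_average hv hZ.w_test, zero_add, hp]
    simp only [hZ.w]
  have hne1 : ∀ r i, r ≠ Slot.p → Z1 (Sum.inr r) i = Z (Sum.inr r) i := by
    intro r i hr
    rw [hZ1, writeSlot_apply, if_neg (by simpa using hr)]
  clear_value Z1
  have h2 := fun g => h1'.writeSlot (r := .khat) (by decide) (by decide) (by decide) (by decide) g
  rw [evalMLP_apply _ _ _ h1'.one, productMLP_apply _ _ _ _ _ (h2 _).one]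
  simp [readout, writeSlot_apply, coord_dotProduct, Matrix.col_apply, p1, hne1, hZ.k_test,
    hZ.y_test, hZ.khat_test, hk]

end

/-! The error bound. -/

/-- From ab = ((a + b)² - (a - b)²)/4: two errors of size ε, divided by 4. -/
theorem abs_mul_sub_polarization_le {φ : ReluNet} {R ε : ℝ}
    (hφ : ∀ x : ℝ, |x| ≤ R → |x ^ 2 - φ.eval x| < ε) {a b A B : ℝ} (ha : |a| ≤ A) (hb : |b| ≤ B)
    (hR : A + B ≤ R) : |a * b - 1 / 4 * (φ.eval (a + b) - φ.eval (a - b))| ≤ ε / 2 := by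
  have h1 := abs_lt.1 (hφ (a + b) ((abs_add_le a b).trans (by linarith)))
  have h2 := abs_lt.1 (hφ (a - b) ((abs_sub a b).trans (by linarith)))
  rw [abs_le]
  constructor <;> nlinarith

section

variable {d N : ℕ} {x : Fin N → EuclideanSpace ℝ (Fin d)} {xtest : EuclideanSpace ℝ (Fin d)}
  {v lam0 κ By c η Bw εflip εsq εsqIter εsqOut εinv : ℝ}

theorem isKernel_gaussKernel (hv : 0 < v) (h : ∀ i j, κ ≤ gaussKernel v (x i) (x j)) :
    IsKernel (fun i j => gaussKernel v (x i) (x j)) κ where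
  symm _ _ := gaussKernel_comm _ _ _
  diag _ := gaussKernel_self _ _
  lower := h
  upper _ _ := gaussKernel_le_one _ _ _
  quadratic_nonneg := gaussKernel_quadratic_nonneg hv x

/-- The map x ↦ x/(1 - x) sends 1/(1 + δ) to 1/δ, and δ ≥ N κ places the argument in the range of
accuracy. -/
theorem abs_inv_deg_sub_le {φ : ReluNet} (hN : 1 ≤ N) (hκ : 0 < κ)
    (hφ : ∀ x ∈ Set.Icc 0 (1 / (1 + N * κ)), |x / (1 - x) - φ.eval x| < εflip / N) {δ : ℝ}
    (hδ : N * κ ≤ δ) : |1 / δ - φ.eval (1 / (1 + δ))| ≤ εflip / N := by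
  have hN' : (0 : ℝ) < N := by exact_mod_cast hN
  have hNκ : 0 < N * κ := by positivity
  have hδ0 : 0 < δ := hNκ.trans_le hδ
  have h := hφ (1 / (1 + δ)) ⟨by positivity, by gcongr⟩
  have e : 1 / (1 + δ) / (1 - 1 / (1 + δ)) = 1 / δ := by
    have : 1 - 1 / (1 + δ) = δ / (1 + δ) := by field_simp; ring
    rw [this]
    field_simp
  rw [e] at h
  exact h.le

theorem abs_alpha_le (hN : 1 ≤ N) (hκ : 0 < κ) (hε : εflip ≤ 1) {δ a : ℝ} (hδ : N * κ ≤ δ)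
    (ha : |1 / δ - a| ≤ εflip / N) : |a| ≤ boundAlpha N κ := by
  have hN' : (0 : ℝ) < N := by exact_mod_cast hN
  have hNκ : 0 < N * κ := by positivity
  have hδ0 : 0 < δ := hNκ.trans_le hδ
  have h1 : 1 / δ ≤ 1 / (N * κ) := by gcongr
  have h2 : εflip / N ≤ 1 / N := by gcongr
  have h3 : 0 < 1 / δ := by positivity
  have h4 : 0 < 1 / (N * κ) := by positivity
  rw [abs_le] at ha ⊢
  unfold boundAlpha
  constructor <;> linarith

/-- The error added by one step of the iteration, divided by `η`. -/
noncomputable def stepError (lam0 By εflip εsq εsqIter : ℝ) : ℝ :=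
  By / √lam0 * εflip + (εsq + lam0 * εsqIter) / 2

theorem stepError_nonneg (hlam0 : 0 < lam0) (hBy : 0 ≤ By) (hflip : 0 ≤ εflip) (hsq : 0 ≤ εsq)
    (hsqIter : 0 ≤ εsqIter) : 0 ≤ stepError lam0 By εflip εsq εsqIter := by
  unfold stepError
  positivity

theorem stepError_le (hlam0 : 0 < lam0) (hsq : 0 ≤ εsq) (hsqIter : 0 ≤ εsqIter) :
    stepError lam0 By εflip εsq εsqIter ≤
      By / √lam0 * εflip + (1 + lam0) * (εsq + εsqIter) := by
  unfold stepError
  nlinarith [mul_nonneg hlam0.le hsqIter, mul_nonneg hlam0.le hsq]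

theorem wnorm_bound_div_le (hκ : 0 < κ) (hlam0 : 0 < lam0) (hc : c < 1)
    (hsq : 0 ≤ εsq) (hsqIter : 0 ≤ εsqIter) {e r : ℝ}
    (he : e ≤ r * ((1 / √lam0 + 1) * By / lam0) +
      stepError lam0 By εflip εsq εsqIter / (lam0 * (1 - c))) :
    e / √κ ≤ r * ((1 / √lam0 + 1) * By / (lam0 * √κ)) +
      (By / √lam0 * εflip + (1 + lam0) * (εsq + εsqIter)) / (lam0 * (1 - c) * √κ) := by
  have h1 : 0 < 1 - c := by linarith
  have h2 : 0 < √κ := Real.sqrt_pos.2 hκ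
  have h3 := stepError_le (By := By) (εflip := εflip) hlam0 hsq hsqIter
  calc e / √κ ≤ (r * ((1 / √lam0 + 1) * By / lam0) +
      (By / √lam0 * εflip + (1 + lam0) * (εsq + εsqIter)) / (lam0 * (1 - c))) / √κ := by
        gcongr
        exact he.trans (by gcongr)
    _ = _ := by
        rw [add_div, mul_div_assoc, div_div, div_div]

/-- The distance to w* contributes the 1/√N part of `boundW` and w* itself the 1/N part, after r and
the accuracies are replaced by 1. The outcome does not depend on the number of iterations, so one
fixed `Bw` serves them all. -/
theorem abs_iterate_le (hN : 1 ≤ N) (hlam0 : 0 < lam0) (hκ : 0 < κ) (hBy : 0 ≤ By) (hc : c < 1)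
    (hflip' : εflip ≤ 1) (hsq : 0 ≤ εsq) (hsq' : εsq ≤ 1)
    (hsqIter : 0 ≤ εsqIter) (hsqIter' : εsqIter ≤ 1)
    {K : Fin N → Fin N → ℝ} (hK : IsKernel K κ) {y wstar w : Fin N → ℝ} (hy : ∀ i, |y i| ≤ By)
    (hw : ∀ i, ∑ j, K i j * wstar j + N * lam0 * wstar i = y i) {r : ℝ} (hr : r ≤ 1)
    (he : wnorm (deg K) (fun i => w i - wstar i) ≤ r * ((1 / √lam0 + 1) * By / lam0) +
      stepError lam0 By εflip εsq εsqIter / (lam0 * (1 - c))) (i : Fin N) :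
    |w i| ≤ boundW N lam0 κ By c := by
  have : Nonempty (Fin N) := ⟨i⟩
  have hc' : 0 < 1 - c := by linarith
  have hκ' : 0 < √κ := Real.sqrt_pos.2 hκ
  have h1 := hK.abs_le_wnorm hκ (fun i => w i - wstar i) i
  have h2 := hK.abs_solution_le (By := By) hlam0 hBy hy (by simpa using hw) i
  rw [Fintype.card_fin] at h1 h2
  have h3 := wnorm_bound_div_le (By := By) hκ hlam0 hc hsq hsqIter he
  have h4 : r * ((1 / √lam0 + 1) * By / (lam0 * √κ)) ≤ initConst lam0 κ By := by
    unfold initConst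
    exact mul_le_of_le_one_left (by positivity) hr
  have h5 : (By / √lam0 * εflip + (1 + lam0) * (εsq + εsqIter)) / (lam0 * (1 - c) * √κ) ≤
      errConst lam0 κ By c := by
    unfold errConst
    have : By / √lam0 * εflip ≤ By / √lam0 := mul_le_of_le_one_right (by positivity) hflip'
    have : (1 + lam0) * (εsq + εsqIter) ≤ 2 * (1 + lam0) := by nlinarith
    gcongr ?_ / _
    linarith
  have h6 : wnorm (deg K) (fun i => w i - wstar i) / √κ / √N ≤
      (initConst lam0 κ By + errConst lam0 κ By c) / √N := by
    gcongr
    linarith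
  have h7 : |w i| ≤ |w i - wstar i| + |wstar i| := by
    simpa using abs_add_le (w i - wstar i) (wstar i)
  unfold boundW
  linarith

theorem boundW_le_boundWTilde (hN : 1 ≤ N) (hlam0 : 0 < lam0) (hκ : 0 < κ) (hBy : 0 ≤ By)
    (hc : c < 1) : boundW N lam0 κ By c ≤ boundWTilde lam0 κ By c := by
  have hN' : (1 : ℝ) ≤ N := by exact_mod_cast hN
  have hc' : 0 < 1 - c := by linarith
  have h1 : 0 ≤ initConst lam0 κ By := by unfold initConst; positivity
  have h2 : 0 ≤ errConst lam0 κ By c := by unfold errConst; positivity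
  unfold boundW boundWTilde
  refine add_le_add (div_le_self (by positivity) (Real.one_le_sqrt.2 hN')) ?_
  refine div_le_div_of_nonneg_left (by positivity) hlam0 ?_
  exact le_mul_of_one_le_right hlam0.le hN'

/-- After `ℓ` iterations the network holds an iterate close to the solution. -/
theorem exists_iterState (hN : 1 ≤ N) (hv : 0 < v) (hlam0 : 0 < lam0) (hκ : 0 < κ)
    (hBy : 0 ≤ By) (hc : c < 1) (hη : 0 < η) (hη' : η ≤ 2 / (1 + lam0 + lam0 / κ))
    (hBw : boundW N lam0 κ By c ≤ Bw) (hflip : 0 < εflip) (hflip' : εflip ≤ c)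
    (hsq : 0 < εsq) (hsq' : εsq < 1) (hsqIter : 0 < εsqIter) (hsqIter' : εsqIter < 1)
    {Φ : Approximants} (hΦ : Φ.Accurate N κ By Bw εflip εsq εsqIter εsqOut εinv)
    {y wstar : Fin N → ℝ} (hx : ∀ i j, κ ≤ gaussKernel v (x i) (x j)) (hy : ∀ i, |y i| ≤ By)
    (hw : ∀ i, ∑ j, gaussKernel v (x i) (x j) * wstar j + N * lam0 * wstar i = y i) (ℓ : ℕ) :
    ∃ α β w : Fin N → ℝ, IterState x xtest v α β w
      (runBlocks (readInBlocks d N v η (boundAlpha N κ) Φ ++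
        (List.replicate ℓ (iterBlocks d N v η (N * lam0) Bw Φ)).flatten) (prompt x y xtest)) ∧
      wnorm (deg fun i j => gaussKernel v (x i) (x j)) (fun i => w i - wstar i) ≤
        (1 - η * lam0 * (1 - c)) ^ ℓ * ((1 / √lam0 + 1) * By / lam0) +
          stepError lam0 By εflip εsq εsqIter / (lam0 * (1 - c)) := by
  have hN' : (0 : ℝ) < N := by exact_mod_cast hN
  have : Nonempty (Fin N) := ⟨⟨0, hN⟩⟩
  have hc' : 0 < 1 - c := by linarith
  have hK := isKernel_gaussKernel hv hx
  set K : Fin N → Fin N → ℝ := fun i j => gaussKernel v (x i) (x j) with hKdef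
  have hdκ : ∀ i, N * κ ≤ deg K i := fun i => by simpa using hK.le_deg i
  set α : Fin N → ℝ := fun i => Φ.flip.eval (1 / (1 + deg K i)) with hα
  have hα1 : ∀ i, |1 / deg K i - α i| ≤ εflip / N := fun i =>
    abs_inv_deg_sub_le hN hκ hΦ.flip (hdκ i)
  have hα2 : ∀ i, |α i| ≤ boundAlpha N κ := fun i =>
    abs_alpha_le hN hκ (by linarith) (hdκ i) (hα1 i)
  have hF := stepError_nonneg hlam0 hBy hflip.le hsq.le hsqIter.le
  have hρ := rate_pos hκ hK.le_one hlam0 (hflip.trans_le hflip') hη hη'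
  have hρ1 : 1 - η * lam0 * (1 - c) ≤ 1 := by
    have : 0 < η * lam0 * (1 - c) := by positivity
    linarith
  refine ⟨α, fun i => η / 4 * (Φ.sq.eval (y i + α i) - Φ.sq.eval (y i - α i)), ?_⟩
  induction ℓ with
  | zero =>
    refine ⟨fun _ => 0, ?_, ?_⟩
    · rw [List.replicate_zero, List.flatten_nil, List.append_nil]
      exact iterState_readIn hv (α := α) (fun i => rfl) hα2
    · have h1 : ∀ i, |0 - wstar i| ≤ (1 / √lam0 + 1) * By / (lam0 * N) := fun i => by
        simpa using hK.abs_solution_le (By := By) hlam0 hBy hy (by simpa using hw) i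
      have h2 := wnorm_le_of_abs_le hK.deg_le h1 (by positivity)
      rw [Fintype.card_fin] at h2
      have h3 : (N : ℝ) * ((1 / √lam0 + 1) * By / (lam0 * N)) =
          (1 / √lam0 + 1) * By / lam0 := by field_simp
      rw [h3] at h2
      rw [pow_zero, one_mul]
      exact h2.trans (le_add_of_nonneg_right (by positivity))
  | succ ℓ ih =>
    obtain ⟨w, hw1, hw2⟩ := ih
    -- The norm bound at stage ℓ keeps the iterate where clearing is harmless and `Φ.sqIter` is
    -- accurate, which permits the next step.
    have hwB := abs_iterate_le hN hlam0 hκ hBy hc (by linarith) hsq.le hsq'.le hsqIter.le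
      hsqIter'.le hK hy hw (pow_le_one₀ hρ.le hρ1) hw2
    have hwB' : ∀ i, |w i| ≤ Bw := fun i => (hwB i).trans hBw
    have hBw0 : 0 ≤ Bw := (boundW_nonneg hlam0 hκ hBy hc).trans hBw
    refine ⟨fun i => w i - η * (N * lam0) / 4 *
      (Φ.sqIter.eval (w i + α i) - Φ.sqIter.eval (w i - α i)) +
      η / 4 * (Φ.sq.eval (y i + α i) - Φ.sq.eval (y i - α i)) +
      η * -((∑ j, K i j * w j) / ∑ j, K i j), ?_, ?_⟩
    · rw [List.replicate_succ', List.flatten_append, ← List.append_assoc, runBlocks_append,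
        List.flatten_singleton]
      exact hw1.iterate hv hBw0 hwB'
    · refine le_trans (hK.wnorm_step_le (τ := (εsq + lam0 * εsqIter) / 2) hκ hlam0 hflip hflip' hη
        hη' hBy (by positivity) (w := w) (by simpa using hα1) hy (by simpa using hw) ?_) ?_
      · intro i
        rw [Fintype.card_fin]
        have h1 := abs_mul_sub_polarization_le hΦ.sqIter (hwB' i) (hα2 i) le_rfl
        have h2 := abs_mul_sub_polarization_le hΦ.sq (hy i) (hα2 i) le_rfl
        set s := 1 / 4 * (Φ.sqIter.eval (w i + α i) - Φ.sqIter.eval (w i - α i)) with hs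
        set s' := 1 / 4 * (Φ.sq.eval (y i + α i) - Φ.sq.eval (y i - α i)) with hs'
        have e : w i - η * (N * lam0) / 4 *
            (Φ.sqIter.eval (w i + α i) - Φ.sqIter.eval (w i - α i)) +
            η / 4 * (Φ.sq.eval (y i + α i) - Φ.sq.eval (y i - α i)) +
            η * -((∑ j, K i j * w j) / ∑ j, K i j) -
            (w i - η * (N * lam0) * (α i * w i) + η * (y i * α i) -
              η * ((∑ j, K i j * w j) / deg K i)) =
            η * (N * lam0) * (w i * α i - s) + -(η * (y i * α i - s')) := by
          simp only [hs, hs', deg]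
          ring
        rw [e]
        refine (abs_add_le _ _).trans ?_
        rw [abs_neg, abs_mul, abs_mul η (_ - _), abs_of_pos (by positivity : 0 < η * (N * lam0)),
          abs_of_pos hη]
        -- The second power of N in the accuracy of `Φ.sqIter` compensates the factor N in λ = N λ₀.
        calc η * (N * lam0) * |w i * α i - s| + η * |y i * α i - s'|
            ≤ η * (N * lam0) * (εsqIter / N ^ 2 / 2) + η * (εsq / N / 2) := by gcongr
          _ = η * ((εsq + lam0 * εsqIter) / 2) / N := by field_simp; ring
      · change _ + η * stepError lam0 By εflip εsq εsqIter ≤ _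
        -- The floor F/(λ₀(1 - c)), with F the step error, is the fixed point of e ↦ (1 - ηλ₀(1 -
        -- c))e + ηF, so it reproduces itself.
        have h1 := mul_le_mul_of_nonneg_left hw2 hρ.le
        refine (add_le_add_left h1 _).trans_eq ?_
        field_simp
        ring

theorem abs_transformer_sub_le (hN : 1 ≤ N) (hv : 0 < v) (hlam0 : 0 < lam0) (hκ : 0 < κ)
    (hBy : 0 ≤ By) (hc : c < 1) (hη : 0 < η) (hη' : η ≤ 2 / (1 + lam0 + lam0 / κ))
    (hBw : boundW N lam0 κ By c ≤ Bw) (hflip : 0 < εflip) (hflip' : εflip ≤ c)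
    (hsq : 0 < εsq) (hsq' : εsq < 1) (hsqIter : 0 < εsqIter) (hsqIter' : εsqIter < 1)
    (hinv : 0 < εinv) (hinv' : εinv < 1)
    {Φ : Approximants} (hΦ : Φ.Accurate N κ By Bw εflip εsq εsqIter εsqOut εinv)
    {y wstar : Fin N → ℝ} (hx : ∀ i j, κ ≤ gaussKernel v (x i) (x j)) (hy : ∀ i, |y i| ≤ By)
    (hw : ∀ i, ∑ j, gaussKernel v (x i) (x j) * wstar j + N * lam0 * wstar i = y i) (ℓ : ℕ) :
    |readout (runBlocks (transformer d N v η (N * lam0) (boundAlpha N κ) Bw Φ ℓ)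
        (prompt x y xtest)) - ∑ i, wstar i * gaussKernel v (x i) xtest| ≤
      (1 - η * lam0 * (1 - c)) ^ ℓ * ((1 / √lam0 + 1) * By / (lam0 * √κ))
        + (By / √lam0 * εflip + (1 + lam0) * (εsq + εsqIter)) / (lam0 * (1 - c) * √κ)
        + εsqOut / 2 + εinv * boundWTilde lam0 κ By c := by
  have hN' : (1 : ℝ) ≤ N := by exact_mod_cast hN
  have hN0 : (0 : ℝ) < N := by linarith
  have : Nonempty (Fin N) := ⟨⟨0, hN⟩⟩
  have hc' : 0 < 1 - c := by linarith
  have hK := isKernel_gaussKernel hv hx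
  have hρ := rate_pos hκ hK.le_one hlam0 (hflip.trans_le hflip') hη hη'
  have hρ1 : 1 - η * lam0 * (1 - c) ≤ 1 := by
    have : 0 < η * lam0 * (1 - c) := by positivity
    linarith
  obtain ⟨α, β, w, hw1, hw2⟩ := exists_iterState (xtest := xtest) hN hv hlam0 hκ hBy hc hη hη' hBw
    hflip hflip' hsq hsq' hsqIter hsqIter' hΦ hx hy hw ℓ
  have hwB := abs_iterate_le hN hlam0 hκ hBy hc (by linarith) hsq.le hsq'.le hsqIter.le
    hsqIter'.le hK hy hw (pow_le_one₀ hρ.le hρ1) hw2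
  have hB0 := boundW_nonneg (N := N) hlam0 hκ hBy hc
  set δ : ℝ := ∑ j, gaussKernel v xtest (x j) with hδ
  have hδ0 : 0 ≤ δ := Finset.sum_nonneg fun j _ => (gaussKernel_pos _ _ _).le
  have hδN : δ ≤ N :=
    (Finset.sum_le_sum fun j _ => gaussKernel_le_one v xtest (x j)).trans_eq (by simp)
  set kh : ℝ := Φ.inv.eval (1 / (1 + δ)) with hkh
  set p : ℝ := (∑ j, gaussKernel v xtest (x j) * w j) / (1 + δ) with hp
  have hpB : |p| ≤ boundW N lam0 κ By c :=
    abs_weighted_average_le (fun j => (gaussKernel_pos _ _ _).le) (by linarith) (by linarith) hB0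
      hwB
  have hkd : |1 + δ - kh| ≤ εinv := by
    have h := hΦ.inv (1 / (1 + δ)) ⟨by apply one_div_le_one_div_of_le <;> linarith, by
      rw [div_le_one (by linarith)]; linarith⟩
    rw [one_div_one_div] at h
    exact h.le
  -- Here |kh| ≤ 1 + δ + εinv ≤ N + 2 ≤ 3N, which is the origin of the 3 in the range of `Φ.sqOut`.
  have hkb : |1 / N * kh| ≤ 3 := by
    rw [abs_mul, abs_of_pos (by positivity), div_mul_eq_mul_div, one_mul, div_le_iff₀ hN0]
    rw [abs_le] at hkd ⊢
    constructor <;> linarith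
  have hread := hw1.readout_readOut hv hkh hp
  rw [transformer, runBlocks_append, hread]
  have h1 := abs_mul_sub_polarization_le hΦ.sqOut hkb (hpB.trans hBw) (by linarith)
  set s := 1 / 4 * (Φ.sqOut.eval (1 / N * kh + p) - Φ.sqOut.eval (1 / N * kh - p)) with hs
  -- Three sources of error: the final product, the approximate normalizer kh in place of 1 + δ, and
  -- the iterate w in place of w*.
  have e : N / 4 * (Φ.sqOut.eval (1 / N * kh + p) - Φ.sqOut.eval (1 / N * kh - p)) -
      ∑ i, wstar i * gaussKernel v (x i) xtest = -(N * (1 / N * kh * p - s)) +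
        -((1 + δ - kh) * p) + ∑ i, (w i - wstar i) * gaussKernel v (x i) xtest := by
    have h2 : (1 + δ) * p = ∑ i, w i * gaussKernel v (x i) xtest := by
      rw [hp, mul_div_cancel₀ _ (by linarith)]
      exact Finset.sum_congr rfl fun i _ => by rw [gaussKernel_comm, mul_comm]
    have h3 : (N : ℝ) * (1 / N * kh * p) = kh * p := by field_simp
    simp only [sub_mul, Finset.sum_sub_distrib, ← h2, mul_sub, h3, hs]
    ring
  rw [e]
  have h4 : |-(N * (1 / N * kh * p - s))| ≤ εsqOut / 2 := by
    rw [abs_neg, abs_mul, abs_of_pos hN0]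
    calc N * |1 / N * kh * p - s| ≤ N * (εsqOut / N / 2) := by gcongr
      _ = εsqOut / 2 := by field_simp
  have h5 : |-((1 + δ - kh) * p)| ≤ εinv * boundWTilde lam0 κ By c := by
    rw [abs_neg, abs_mul]
    exact mul_le_mul hkd (hpB.trans (boundW_le_boundWTilde hN hlam0 hκ hBy hc)) (abs_nonneg _)
      hinv.le
  have h6 := hK.abs_sum_mul_le_wnorm hκ (fun i => w i - wstar i)
    (fun i => gaussKernel v (x i) xtest) (fun i => (gaussKernel_pos _ _ _).le)
    (fun i => gaussKernel_le_one _ _ _)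
  have h7 := wnorm_bound_div_le (By := By) hκ hlam0 hc hsq.le hsqIter.le hw2
  refine (abs_add_le _ _).trans ?_
  have h8 := abs_add_le (-(N * (1 / N * kh * p - s))) (-((1 + δ - kh) * p))
  linarith

end

end KernelTransformer

theorem mainTheorem2 (d N : ℕ) (hN : 1 ≤ N)
    (v lam0 κ By c η Bw εflip εsq εsqIter εsqOut εinv : ℝ)
    (hv : 0 < v) (hlam0 : 0 < lam0) (hκ : 0 < κ) (hBy : 0 ≤ By) (hc : c < 1)
    (hη : 0 < η) (hη' : η ≤ 2 / (1 + lam0 + lam0 / κ))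
    (hBw : KernelTransformer.boundW N lam0 κ By c ≤ Bw)
    (hflip : 0 < εflip) (hflip' : εflip ≤ c)
    (hsq : 0 < εsq) (hsq' : εsq < 1) (hsqIter : 0 < εsqIter) (hsqIter' : εsqIter < 1)
    (hsqOut : 0 < εsqOut) (hsqOut' : εsqOut < 1) (hinv : 0 < εinv) (hinv' : εinv < 1) :
    (∃ Φ : KernelTransformer.Approximants,
      Φ.Accurate N κ By Bw εflip εsq εsqIter εsqOut εinv ∧
      Φ.Small N κ By Bw εflip εsq εsqIter εsqOut εinv) ∧
    ∀ Φ : KernelTransformer.Approximants,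
      Φ.Accurate N κ By Bw εflip εsq εsqIter εsqOut εinv →
      ∀ (ℓ : ℕ) (x : Fin N → EuclideanSpace ℝ (Fin d)) (xtest : EuclideanSpace ℝ (Fin d))
        (y wstar : Fin N → ℝ),
        (∀ i j, κ ≤ KernelTransformer.gaussKernel v (x i) (x j)) →
        (∀ i, κ ≤ KernelTransformer.gaussKernel v (x i) xtest) →
        (∀ i, |y i| ≤ By) →
        (KernelTransformer.kernelMatrix v x + ((N : ℝ) * lam0) • (1 : Matrix (Fin N) (Fin N) ℝ))
          *ᵥ wstar = y →
        |KernelTransformer.readout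
            (KernelTransformer.runBlocks
              (KernelTransformer.transformer d N v η (N * lam0)
                (KernelTransformer.boundAlpha N κ) Bw Φ ℓ)
              (KernelTransformer.prompt x y xtest))
          - ∑ i, wstar i * KernelTransformer.gaussKernel v (x i) xtest|
        ≤ (1 - η * lam0 * (1 - c)) ^ ℓ * ((1 / √lam0 + 1) * By / (lam0 * √κ))
          + (By / √lam0 * εflip + (1 + lam0) * (εsq + εsqIter)) / (lam0 * (1 - c) * √κ)
          + εsqOut / 2 + εinv * KernelTransformer.boundWTilde lam0 κ By c := by
  refine ⟨KernelTransformer.exists_approximants hN hlam0 hκ hBy hc hBw hflip hsq hsqIter hsqOut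
    hinv hinv', fun Φ hΦ ℓ x xtest y wstar hx _ hy hw => ?_⟩
  refine KernelTransformer.abs_transformer_sub_le hN hv hlam0 hκ hBy hc hη hη' hBw hflip hflip' hsq
    hsq' hsqIter hsqIter' hinv hinv' hΦ hx hy (fun i => ?_) ℓ
  rw [← hw, Matrix.add_mulVec, Matrix.smul_mulVec, Matrix.one_mulVec]
  rfl
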